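/- Let $G$ be a connected finite-dimensional Lie group with identity $e$ and Lie algebra $\mathfrak g=T_eG$, whose bracket is that of left-invariant vector fields. Let $\langle\cdot,\cdot\rangle$ be a bi-invariant Riemannian metric on $G$, with Riemannian distance $d$, Levi-Civita connection $\nabla$, covariant derivative $D_t$ along curves, and curvature $R(X,Y)Z=\nabla_X\nabla_YZ-\nabla_Y\nabla_XZ-\nabla_{[X,Y]}Z$. For $\xi,\eta\in\mathfrak g$ put $\nabla^{\mathfrak g}_\xi\eta=(\nabla_{\phi(\xi)}\phi(\eta))(e)$, where $\phi(\xi)$ is the left-invariant vector field with value $\xi$ at $e$. Then for all $\xi,\eta,\sigma\in\mathfrak g$ $$\nabla^{\mathfrak g}_\xi\eta=\tfrac12[\xi,\eta],\qquad R(\xi,\eta)\sigma=-\tfrac14[[\xi,\eta],\sigma],$$ and every function on $G\times G$ of the form $(p,q)\mapsto f(d(p,q)^2)$, $f:\mathbb R\to\mathbb R$, is left-invariant, i.e. its value at $(hp,hq)$ is that at $(p,q)$ for all $h\in G$. Moreover, let an undirected graph on the agents $1,\dots,s$ be given, with $\mathcal N_j$ the set of neighbors of $j$, and for all $j$ and $k\in\mathcal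 N_j$ let $V_{jk}:G\times G\to\mathbb R$ be smooth and left-invariant (for instance a smooth potential $V_{jk}=f(d^2)$). Write $\mathrm{grad}_1V_{jk}$ for the gradient with respect to the first argument. Let $a<b$, let $g_1,\dots,g_s:[a,b]\to G$ be smooth curves, and put $\xi_j=g_j^{-1}\dot g_j$ and $h_{jk}=g_j^{-1}g_k$. Then the following are equivalent. 1. (Necessary conditions for optimality in the collision avoidance problem.) For all $j$, on $[a,b]$, $$D_t^3\dot g_j+R(D_t\dot g_j,\dot g_j)\dot g_j=-\sum_{r\in\mathcal N_j}\mathrm{grad}_1V_{jr}(g_j,g_r).$$ 2. (Reduced necessary conditions.) There are curves $\xi_j^{(1)},\xi_j^{(2)}$ in $\mathfrak g$ such that, with $\xi_j^{(0)}=\xi_j$, for all $j$ and $k\in\mathcal N_j$ and $i=0,1$, on $[a,b]$, $$\dot h_{jk}=-\xi_jh_{jk}+h_{jk}\xi_k,\qquad \dot\xi_j^{(i)}=\xi_j^{(i+1)}-\nabla^{\mathfrak g}_{\xi_j}\xi_j^{(i)},$$ $$\dot\xi_j^{(2)}+\nabla^{\mathfrak g}_{\xi_j}\xi_j^{(2)}+R(\xi_j^{(1)},\xi_j)\xi_j=-\sum_{r\in\mathcal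 N_j}\mathrm{grad}_1V_{jr}(e,h_{jr}).$$ 3. For all $j$ and $k\in\mathcal N_j$, on $[a,b]$, $$\dot h_{jk}=-\xi_jh_{jk}+h_{jk}\xi_k,\qquad \dddot\xi_j+[\xi_j,\ddot\xi_j]=-\sum_{r\in\mathcal N_j}\mathrm{grad}_1V_{jr}(e,h_{jr}).$$ -/

import Mathlib

open Bundle Manifold Set
open scoped ContDiff

noncomputable section

namespace CollisionAvoidance

section Riemannian

variable {E : Type*} [NormedAddCommGroup E] [NormedSpace ℝ E]
  {H : Type*} [TopologicalSpace H] {I : ModelWithCorners ℝ E H}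
  {M : Type*} [TopologicalSpace M] [ChartedSpace H M]

/-- The velocity `q̇(t)` of a curve `q` defined on a set `s ⊆ ℝ` of times (one-sided at the
endpoints when `s` is a compact interval). -/
def velocity (I : ModelWithCorners ℝ E H) (s : Set ℝ) (q : ℝ → M) (t : ℝ) :
    TangentSpace I (q t) :=
  mfderivWithin 𝓘(ℝ, ℝ) I q s t (1 : ℝ)

/-- The gradient of a function on a Riemannian manifold: the vector which the metric identifies
with the differential, `⟨grad f (x), v⟩ = df_x (v)`. -/
def grad (I : ModelWithCorners ℝ E H) [FiniteDimensional ℝ E]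
    [RiemannianBundle (fun x : M ↦ TangentSpace I x)] [IsManifold I 1 M]
    (f : M → ℝ) (x : M) : TangentSpace I x :=
  haveI : FiniteDimensional ℝ (TangentSpace I x) := inferInstanceAs (FiniteDimensional ℝ E)
  haveI : CompleteSpace (TangentSpace I x) := FiniteDimensional.complete ℝ _
  (InnerProductSpace.toDual ℝ (TangentSpace I x)).symm (mvfderiv I f x)

/-- The gradient of `V : M × M → ℝ` with respect to the first argument, at `(p, x)`. -/
def grad₁ (I : ModelWithCorners ℝ E H) [FiniteDimensional ℝ E]
    [RiemannianBundle (fun x : M ↦ TangentSpace I x)] [IsManifold I 1 M]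
    (V : M → M → ℝ) (p x : M) : TangentSpace I p :=
  grad I (fun q ↦ V q x) p

/-- The distance `d(x, y)` of a (connected) Riemannian manifold: the infimum of the lengths of the
`C¹` paths from `x` to `y`. -/
def riemDist (I : ModelWithCorners ℝ E H)
    [RiemannianBundle (fun x : M ↦ TangentSpace I x)] (x y : M) : ℝ :=
  (riemannianEDist I x y).toReal

/-- An affine connection is the Levi-Civita connection if it is torsion-free and compatible with
the metric. -/
def IsLeviCivita [FiniteDimensional ℝ E] [CompleteSpace E] [IsManifold I ∞ M]
    [RiemannianBundle (fun x : M ↦ TangentSpace I x)]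
    [IsContMDiffRiemannianBundle I ∞ E (fun x : M ↦ TangentSpace I x)]
    (cov : CovariantDerivative I E (fun x : M ↦ TangentSpace I x)) : Prop :=
  CovariantDerivative.torsion cov = 0 ∧
    CovariantDerivative.IsMetricCompatible (F := E) (V := fun x : M ↦ TangentSpace I x) cov

/-- The covariant derivative `D_t W` along `q` of a vector field `W` along `q`. In the
trivialization of the tangent bundle around `q(t)`, write `W(τ) = ∑ᵢ wⁱ(τ) eᵢ(q(τ))` with the frame
fields `eᵢ`; then `D_t W (t) = ∑ᵢ ẇⁱ(t) eᵢ(q(t)) + ∇_{q̇(t)} (∑ᵢ wⁱ(t) eᵢ)`. The vector field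
`∑ᵢ wⁱ(t) eᵢ`, with constant coefficients, is `FiberBundle.extend E (W t)`. -/
def covDerivAlong [IsManifold I 1 M]
    (cov : CovariantDerivative I E (fun x : M ↦ TangentSpace I x))
    (s : Set ℝ) (q : ℝ → M) (W : ∀ t, TangentSpace I (q t)) (t : ℝ) : TangentSpace I (q t) :=
  (trivializationAt E (fun x : M ↦ TangentSpace I x) (q t)).symm (q t)
      (derivWithin (fun τ ↦ ((trivializationAt E (fun x : M ↦ TangentSpace I x) (q t))
        (⟨q τ, W τ⟩ : TangentBundle I M)).2) s t)
    + cov (FiberBundle.extend E (W t)) (q t) (velocity I s q t)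

/-- `R(X, Y)Z = ∇_X ∇_Y Z - ∇_Y ∇_X Z - ∇_{[X, Y]} Z` for vector fields `X`, `Y`, `Z`. -/
def curvatureField [IsManifold I 1 M]
    (cov : CovariantDerivative I E (fun x : M ↦ TangentSpace I x))
    (X Y Z : ∀ x : M, TangentSpace I x) (x : M) : TangentSpace I x :=
  cov (fun y ↦ cov Z y (Y y)) x (X x) - cov (fun y ↦ cov Z y (X y)) x (Y x)
    - cov Z x (VectorField.mlieBracket I X Y x)

/-- The curvature endomorphism `R(u, v)w` on tangent vectors `u`, `v`, `w` at `x`, computed with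
vector fields that extend them and are smooth near `x`. -/
def curvature [IsManifold I 1 M] (cov : CovariantDerivative I E (fun x : M ↦ TangentSpace I x))
    {x : M} (u v w : TangentSpace I x) : TangentSpace I x :=
  curvatureField cov (FiberBundle.extend E u) (FiberBundle.extend E v) (FiberBundle.extend E w) x

/-- The necessary conditions for optimality in the collision avoidance problem, on the set `s` of
times: `D_t³ q̇ⱼ + R(D_t q̇ⱼ, q̇ⱼ) q̇ⱼ = - ∑_{r ∈ Nⱼ} grad₁ Vⱼᵣ (qⱼ, qᵣ)` for every agent `j`. -/
def NecessaryConditions [FiniteDimensional ℝ E] [IsManifold I 1 M]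
    [RiemannianBundle (fun x : M ↦ TangentSpace I x)]
    (cov : CovariantDerivative I E (fun x : M ↦ TangentSpace I x))
    {n : ℕ} (𝒢 : SimpleGraph (Fin n)) [DecidableRel 𝒢.Adj] (V : Fin n → Fin n → M → M → ℝ)
    (s : Set ℝ) (q : Fin n → ℝ → M) : Prop :=
  ∀ j, ∀ t ∈ s,
    covDerivAlong cov s (q j) (covDerivAlong cov s (q j) (covDerivAlong cov s (q j)
        (velocity I s (q j)))) t
      + curvature cov (covDerivAlong cov s (q j) (velocity I s (q j)) t)
          (velocity I s (q j) t) (velocity I s (q j) t)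
    = - ∑ r ∈ 𝒢.neighborFinset j, grad₁ I (V j r) (q j t) (q r t)

end Riemannian

section LieGroup

variable {E : Type*} [NormedAddCommGroup E] [NormedSpace ℝ E]
  {H : Type*} [TopologicalSpace H] {I : ModelWithCorners ℝ E H}
  {G : Type*} [TopologicalSpace G] [ChartedSpace H G] [Group G]

/-- A Riemannian metric on a Lie group is bi-invariant if all left and all right translations
preserve it. -/
def IsBiInvariantMetric (I : ModelWithCorners ℝ E H) (G : Type*) [TopologicalSpace G]
    [ChartedSpace H G] [Group G] [RiemannianBundle (fun x : G ↦ TangentSpace I x)] : Prop :=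
  (∀ (g x : G) (u v : TangentSpace I x),
    inner ℝ (mfderiv I I (fun y ↦ g * y) x u) (mfderiv I I (fun y ↦ g * y) x v) = inner ℝ u v) ∧
  (∀ (g x : G) (u v : TangentSpace I x),
    inner ℝ (mfderiv I I (fun y ↦ y * g) x u) (mfderiv I I (fun y ↦ y * g) x v) = inner ℝ u v)

/-- A function of two variables on a group which is invariant under simultaneous left
translation. -/
def IsLeftInvariant (V : G → G → ℝ) : Prop := ∀ h p q, V (h * p) (h * q) = V p q

/-- `g⁻¹ u ∈ 𝔤 = T_e G` for a tangent vector `u ∈ T_g G`. -/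
def leftPull {g : G} (u : TangentSpace I g) : GroupLieAlgebra I G :=
  mfderiv I I (fun x ↦ g⁻¹ * x) g u

/-- `g ξ ∈ T_g G` for `ξ ∈ 𝔤`. -/
def leftPush (g : G) (ξ : GroupLieAlgebra I G) : TangentSpace I g :=
  mulInvariantVectorField ξ g

/-- `ξ g ∈ T_g G` for `ξ ∈ 𝔤`. -/
def rightPush (g : G) (ξ : GroupLieAlgebra I G) : TangentSpace I g :=
  mfderiv I I (fun x ↦ x * g) (1 : G) ξ

/-- The Riemannian `𝔤`-connection `∇^𝔤_ξ η = (∇_{φ(ξ)} φ(η))(e)`, where `φ(ξ)` is the left-invariant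
vector field with value `ξ` at `e`. -/
def gConnection [IsManifold I 1 G] (cov : CovariantDerivative I E (fun x : G ↦ TangentSpace I x))
    (ξ η : GroupLieAlgebra I G) : GroupLieAlgebra I G :=
  cov (mulInvariantVectorField η) (1 : G) (mulInvariantVectorField ξ (1 : G))

/-- The reduced velocity `ξ(t) = g(t)⁻¹ ġ(t)` of a curve `g` in `G`. -/
def bodyVelocity (I : ModelWithCorners ℝ E H) (s : Set ℝ) (g : ℝ → G) (t : ℝ) :
    GroupLieAlgebra I G :=
  leftPull (velocity I s g t)

/-- The derivative of a curve in the Lie algebra, on the set `s` of times. -/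
def dot (s : Set ℝ) (ξ : ℝ → GroupLieAlgebra I G) (t : ℝ) : GroupLieAlgebra I G :=
  derivWithin ξ s t

/-- The equations `ḣⱼₖ = -ξⱼ hⱼₖ + hⱼₖ ξₖ` for all agents `j` and all `k ∈ Nⱼ`. -/
def RelativeEquation {n : ℕ} (𝒢 : SimpleGraph (Fin n))
    (s : Set ℝ) (ξ : Fin n → ℝ → GroupLieAlgebra I G) (h : Fin n → Fin n → ℝ → G) : Prop :=
  ∀ j k, 𝒢.Adj j k → ∀ t ∈ s,
    velocity I s (h j k) t = - rightPush (h j k t) (ξ j t) + leftPush (h j k t) (ξ k t)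

/-- The reduced necessary conditions for a left-invariant metric, for `ξⱼ = ξⱼ⁽⁰⁾` and `hⱼₖ`, where
`ξⱼ⁽¹⁾` and `ξⱼ⁽²⁾` are auxiliary unknowns. -/
def ReducedConditions [FiniteDimensional ℝ E] [IsManifold I 1 G]
    [RiemannianBundle (fun x : G ↦ TangentSpace I x)]
    (cov : CovariantDerivative I E (fun x : G ↦ TangentSpace I x))
    {n : ℕ} (𝒢 : SimpleGraph (Fin n)) [DecidableRel 𝒢.Adj] (V : Fin n → Fin n → G → G → ℝ)
    (s : Set ℝ) (ξ : Fin n → ℝ → GroupLieAlgebra I G) (h : Fin n → Fin n → ℝ → G) : Prop :=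
  RelativeEquation 𝒢 s ξ h ∧
  ∃ ξ₁ ξ₂ : Fin n → ℝ → GroupLieAlgebra I G,
    (∀ j, ∀ t ∈ s, dot s (ξ j) t = ξ₁ j t - gConnection cov (ξ j t) (ξ j t)) ∧
    (∀ j, ∀ t ∈ s, dot s (ξ₁ j) t = ξ₂ j t - gConnection cov (ξ j t) (ξ₁ j t)) ∧
    (∀ j, ∀ t ∈ s,
      dot s (ξ₂ j) t + gConnection cov (ξ j t) (ξ₂ j t) + curvature cov (ξ₁ j t) (ξ j t) (ξ j t)
        = - ∑ r ∈ 𝒢.neighborFinset j, grad₁ I (V j r) (1 : G) (h j r t))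

/-- The two equations in the bi-invariant case: `ḣⱼₖ = -ξⱼ hⱼₖ + hⱼₖ ξₖ` and
`ξ⃛ⱼ + [ξⱼ, ξ̈ⱼ] = - ∑_{r ∈ Nⱼ} grad₁ Vⱼᵣ (e, hⱼᵣ)`. -/
def BiInvariantConditions [FiniteDimensional ℝ E] [IsManifold I 1 G]
    [RiemannianBundle (fun x : G ↦ TangentSpace I x)]
    {n : ℕ} (𝒢 : SimpleGraph (Fin n)) [DecidableRel 𝒢.Adj] (V : Fin n → Fin n → G → G → ℝ)
    (s : Set ℝ) (ξ : Fin n → ℝ → GroupLieAlgebra I G) (h : Fin n → Fin n → ℝ → G) : Prop :=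
  RelativeEquation 𝒢 s ξ h ∧
  ∀ j, ∀ t ∈ s,
    dot s (dot s (dot s (ξ j))) t + ⁅ξ j t, dot s (dot s (ξ j)) t⁆
      = - ∑ r ∈ 𝒢.neighborFinset j, grad₁ I (V j r) (1 : G) (h j r t)

end LieGroup

end CollisionAvoidance

end

open Bundle Manifold Set
open scoped ContDiff

noncomputable section

/-! Everything is moved to the Lie algebra by the left trivialization `u ↦ g⁻¹u` of the tangent
bundle.

The first geometric input is the ad-invariance of the inner product at the identity. A
right-invariant field has constant length because the metric is right-invariant, and it commutes
with every left-invariant field (`mlieBracket_leftInvariant_rightInvariant`). Metric compatibility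
and vanishing torsion then give `⟨[u, z], u⟩ = 0` (`metric_bracket_self`). With this, the Koszul
argument yields `∇_u v = ½[u, v]` on left-invariant fields (`cov_leftField`).

Since a connection is determined by its values on a frame, `g⁻¹∇_u Z = dẐ(u) + ½[g⁻¹u, Ẑ]` for every
differentiable field `Z`, where `Ẑ = g⁻¹Z` (`dL_cov`). Applying this twice to coordinate fields,
with the symmetry of second derivatives and the Jacobi identity, gives the curvature
(`dL_curvature`). Along a curve with body velocity `ξ`, the operator `D_t` becomes `w ↦ ẇ + ½[ξ, w]`
(`dL_covDerivAlong`). Hence `ġ, D_tġ, D_t²ġ` become `ξ`, `ξ̇`, `ξ̈ + ½[ξ, ξ̇]`, and `D_t³ġ` becomes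
`ξ⃛ + [ξ, ξ̈] + ¼[ξ, [ξ, ξ̇]]`. The curvature term is exactly `-¼[ξ, [ξ, ξ̇]]`, so only `ξ⃛ + [ξ,
ξ̈]` remains (`dL_necessary`).

On the right-hand side, invariance of `V` and of the metric turns `g⁻¹ grad₁ V(g, x)` into `grad₁
V(e, g⁻¹x)` (`dL_grad₁`). As `u ↦ g⁻¹u` is injective, 1 and 3 are equivalent. For 2 and 3, the
auxiliary curves are forced to be `ξ̇` and `ξ̈ + ½[ξ, ξ̇]`, and the same cancellation occurs. The
equation for `h` holds identically, by the product rule. -/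

namespace CollisionAvoidance

/-! ### Differentials of translations and smoothness of the left trivialization -/

section Translations

variable {E : Type*} [NormedAddCommGroup E] [NormedSpace ℝ E]
  {H : Type*} [TopologicalSpace H] {I : ModelWithCorners ℝ E H}
  {G : Type*} [TopologicalSpace G] [ChartedSpace H G] [Group G]

variable (I) in
/-- The derivative at `x` of the left translation by `a`, as an endomorphism of the model space. -/
def dL (a x : G) : E →L[ℝ] E := mfderiv I I (fun y ↦ a * y) x

variable (I) in
/-- The derivative at `x` of the right translation by `a`, as an endomorphism of the model
space. -/
def dR (a x : G) : E →L[ℝ] E := mfderiv I I (fun y ↦ y * a) x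

variable [LieGroup I ∞ G]

lemma mdifferentiableAt_mulLeft (a x : G) : MDifferentiableAt I I (fun y ↦ a * y) x :=
  (contMDiff_mul_left (I := I) (n := ∞) (a := a)).contMDiffAt.mdifferentiableAt (by simp)

lemma mdifferentiableAt_mulRight (a x : G) : MDifferentiableAt I I (fun y ↦ y * a) x :=
  (contMDiff_mul_right (I := I) (n := ∞) (a := a)).contMDiffAt.mdifferentiableAt (by simp)

lemma dL_dL (a b x : G) (u : E) : dL I a (b * x) (dL I b x u) = dL I (a * b) x u := by
  have h := mfderiv_comp (I := I) (I' := I) (I'' := I) x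
    (mdifferentiableAt_mulLeft a (b * x)) (mdifferentiableAt_mulLeft b x)
  have e : (fun y : G ↦ a * y) ∘ (fun y ↦ b * y) = fun y ↦ (a * b) * y := by
    ext y; simp [mul_assoc]
  rw [e] at h
  exact (DFunLike.congr_fun h u).symm

lemma dR_dR (a b x : G) (u : E) : dR I a (x * b) (dR I b x u) = dR I (b * a) x u := by
  have h := mfderiv_comp (I := I) (I' := I) (I'' := I) x
    (mdifferentiableAt_mulRight a (x * b)) (mdifferentiableAt_mulRight b x)
  have e : (fun y : G ↦ y * a) ∘ (fun y ↦ y * b) = fun y ↦ y * (b * a) := by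
    ext y; simp [mul_assoc]
  rw [e] at h
  exact (DFunLike.congr_fun h u).symm

omit [Group G] [LieGroup I ∞ G] in
lemma mfderiv_eq_id {f : G → G} (hf : f = id) (x : G) :
    (mfderiv I I f x : E →L[ℝ] E) = ContinuousLinearMap.id ℝ E := by
  subst hf
  exact mfderiv_id

omit [Group G] [LieGroup I ∞ G] in
lemma totalSpace_mk_eq {x y : G} {u v : E} (h : x = y) (h' : u = v) :
    (⟨x, u⟩ : TangentBundle I G) = ⟨y, v⟩ := by
  subst h h'
  rfl

omit [LieGroup I ∞ G] in
@[simp] lemma dL_one (x : G) (u : E) : dL I 1 x u = u := by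
  have e : (fun y : G ↦ 1 * y) = id := by ext y; simp
  exact DFunLike.congr_fun (mfderiv_eq_id e x) u

omit [LieGroup I ∞ G] in
@[simp] lemma dR_one (x : G) (u : E) : dR I 1 x u = u := by
  have e : (fun y : G ↦ y * 1) = id := by ext y; simp
  exact DFunLike.congr_fun (mfderiv_eq_id e x) u

lemma dL_inv_dL (g : G) (u : E) : dL I g⁻¹ g (dL I g 1 u) = u := by
  have := dL_dL (I := I) g⁻¹ g 1 u
  simpa using this

lemma dL_dL_inv (g : G) (u : E) : dL I g 1 (dL I g⁻¹ g u) = u := by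
  have := dL_dL (I := I) g g⁻¹ g u
  simpa using this

lemma dL_injective (x : G) : Function.Injective (dL I x⁻¹ x) := fun u v h ↦ by
  rw [← dL_dL_inv (I := I) x u, h, dL_dL_inv]

/-- This is the tangent map of the multiplication, split by the product rule. Inserting a zero
vector in one slot isolates a single translation, which is how the smoothness of the left and right
trivializations is obtained below. -/
lemma contMDiff_tangentMul :
    ContMDiff (I.tangent.prod I.tangent) I.tangent ∞
      (fun p : TangentBundle I G × TangentBundle I G ↦
        (⟨p.1.1 * p.2.1, dR I p.2.1 p.1.1 p.1.2 + dL I p.1.1 p.2.1 p.2.2⟩ : TangentBundle I G)) := by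
  have h₁ : ContMDiff (I.prod I).tangent I.tangent ∞
      (tangentMap (I.prod I) I (fun p : G × G ↦ p.1 * p.2)) :=
    ContMDiff.contMDiff_tangentMap (contMDiff_mul I ∞) (m := ∞) (by simp)
  have h₂ := h₁.comp
    (contMDiff_equivTangentBundleProd_symm (n := ∞) (I := I) (M := G) (I' := I) (M' := G))
  convert! h₂ with p
  rename_i p'
  simp only [Function.comp_apply, tangentMap]
  rw [mfderiv_prod_eq_add_apply ((contMDiff_mul I ∞).mdifferentiable (by simp) _)]
  rfl

omit [Group G] [LieGroup I ∞ G] in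
lemma trivializationAt_self_snd [IsManifold I 1 G] (g : G) (u : TangentSpace I g) :
    (trivializationAt E (fun x : G ↦ TangentSpace I x) g ⟨g, u⟩).2 = u := by
  have := TangentBundle.trivializationAt_apply (I := I) g (⟨g, u⟩ : TangentBundle I G)
  rw [this]
  exact tangentCoordChange_self (I := I) (x := g) (z := g) (v := u) (mem_extChartAt_source g)

/-- The vector `g⁻¹u` is the product, in the tangent group, of the zero vector over `g⁻¹` with `u`.
It lies over the fixed point `1`, where the fiber coordinate of the bundle trivialization is the
vector itself. -/
lemma contMDiff_leftPull :
    ContMDiff I.tangent 𝓘(ℝ, E) ∞ (fun p : TangentBundle I G ↦ dL I p.1⁻¹ p.1 p.2) := by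
  have hproj : ContMDiff I.tangent I ∞ (fun p : TangentBundle I G ↦ p.1) :=
    contMDiff_proj (TangentSpace I)
  have h₀ : ContMDiff I.tangent I.tangent ∞
      (fun p : TangentBundle I G ↦ (⟨p.1⁻¹, 0⟩ : TangentBundle I G)) :=
    (contMDiff_zeroSection ℝ (TangentSpace I)).comp hproj.inv
  have h₁ : ContMDiff I.tangent I.tangent ∞
      (fun p : TangentBundle I G ↦ (⟨1, dL I p.1⁻¹ p.1 p.2⟩ : TangentBundle I G)) := by
    convert! contMDiff_tangentMul.comp (h₀.prodMk contMDiff_id) with p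
    exact totalSpace_mk_eq (inv_mul_cancel p.1).symm
      ((congrArg (· + _) (map_zero (dR I p.1 p.1⁻¹))).trans (zero_add _)).symm
  intro p
  have h₂ := (contMDiffAt_totalSpace.1 (h₁ p)).2
  exact h₂.congr_of_eventuallyEq (.of_forall fun q ↦ (trivializationAt_self_snd (I := I) (1 : G) _).symm)

lemma contMDiff_leftPush :
    ContMDiff (I.prod 𝓘(ℝ, E)) I.tangent ∞
      (fun p : G × E ↦ (⟨p.1, dL I p.1 1 p.2⟩ : TangentBundle I G)) := by
  have h₀ : ContMDiff (I.prod 𝓘(ℝ, E)) I.tangent ∞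
      (fun p : G × E ↦ (⟨p.1, 0⟩ : TangentBundle I G)) :=
    (contMDiff_zeroSection ℝ (TangentSpace I)).comp contMDiff_fst
  have h₁ : ContMDiff (I.prod 𝓘(ℝ, E)) I.tangent ∞
      (fun p : G × E ↦ (⟨1, p.2⟩ : TangentBundle I G)) := by
    intro p
    refine contMDiffAt_totalSpace.2 ⟨contMDiffAt_const, ?_⟩
    refine (contMDiff_snd (n := ∞) p).congr_of_eventuallyEq (.of_forall fun q ↦ ?_)
    exact trivializationAt_self_snd (I := I) (1 : G) _
  convert! contMDiff_tangentMul.comp (h₀.prodMk h₁) with p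
  exact totalSpace_mk_eq (mul_one p.1).symm
    ((congrArg (· + _) (map_zero (dR I 1 p.1))).trans (zero_add _)).symm

lemma contMDiff_rightPush (w : E) :
    ContMDiff I I.tangent ∞ (fun g : G ↦ (⟨g, dR I g 1 w⟩ : TangentBundle I G)) := by
  convert! contMDiff_tangentMul.comp (contMDiff_const (c := (⟨1, w⟩ : TangentBundle I G)).prodMk
    (contMDiff_zeroSection ℝ (TangentSpace I))) with p
  exact totalSpace_mk_eq (one_mul p).symm
    ((congrArg (_ + ·) (map_zero (dL I 1 p))).trans (add_zero _)).symm

end Translations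

/-! ### Lie brackets in the model space -/

section Calculus

variable {E : Type*} [NormedAddCommGroup E] [NormedSpace ℝ E]

/-- Differentiating either field along the other at `c` gives the same mixed second derivative of
`Φ`, by symmetry. It is meant for `Φ` the group multiplication in a chart, whose partial derivatives
produce the left- and right-invariant fields. -/
lemma lieBracket_partial_fderiv_eq_zero {Φ : E × E → E} {c v w : E}
    (hΦ : ContDiffAt ℝ 2 Φ (c, c)) (hv : fderiv ℝ Φ (c, c) (0, v) = v)
    (hw : fderiv ℝ Φ (c, c) (w, 0) = w) :
    VectorField.lieBracket ℝ (fun x ↦ fderiv ℝ Φ (x, c) (0, v))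
      (fun x ↦ fderiv ℝ Φ (c, x) (w, 0)) c = 0 := by
  have hd : DifferentiableAt ℝ (fderiv ℝ Φ) (c, c) :=
    (hΦ.fderiv_right (m := 1) (by norm_num)).differentiableAt one_ne_zero
  have h₁ : HasFDerivAt (fun x : E ↦ fderiv ℝ Φ (x, c) (0, v))
      ((ContinuousLinearMap.apply ℝ E ((0, v) : E × E)).comp
        ((fderiv ℝ (fderiv ℝ Φ) (c, c)).comp (ContinuousLinearMap.inl ℝ E E))) c :=
    (ContinuousLinearMap.apply ℝ E ((0, v) : E × E)).hasFDerivAt.comp c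
      (HasFDerivAt.comp c hd.hasFDerivAt (hasFDerivAt_prodMk_left c c))
  have h₂ : HasFDerivAt (fun x : E ↦ fderiv ℝ Φ (c, x) (w, 0))
      ((ContinuousLinearMap.apply ℝ E ((w, 0) : E × E)).comp
        ((fderiv ℝ (fderiv ℝ Φ) (c, c)).comp (ContinuousLinearMap.inr ℝ E E))) c :=
    (ContinuousLinearMap.apply ℝ E ((w, 0) : E × E)).hasFDerivAt.comp c
      (HasFDerivAt.comp c hd.hasFDerivAt (hasFDerivAt_prodMk_right c c))
  have hs := hΦ.isSymmSndFDerivAt (by simp) (0, v) (w, 0)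
  rw [VectorField.lieBracket, h₁.fderiv, h₂.fderiv, hv, hw]
  simpa [sub_eq_zero] using hs

lemma lieBracket_const (v w z : E) :
    VectorField.lieBracket ℝ (fun _ : E ↦ v) (fun _ ↦ w) z = 0 := by
  simp [VectorField.lieBracket]

end Calculus

/-! ### Coordinate vector fields and second derivatives in charts -/

section Charts

variable {E : Type*} [NormedAddCommGroup E] [NormedSpace ℝ E]
  {H : Type*} [TopologicalSpace H] {I : ModelWithCorners ℝ E H}
  {M : Type*} [TopologicalSpace M] [ChartedSpace H M] [IsManifold I 1 M]
  {F : Type*} [NormedAddCommGroup F] [NormedSpace ℝ F]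

omit [IsManifold I 1 M] in
lemma mvfderiv_congr_point {f : M → F} {x y : M} (h : x = y) (u : E) :
    mvfderiv I f x u = mvfderiv I f y u := by
  subst h
  rfl

lemma mpullbackWithin_extChartAt_symm (V : ∀ y : M, TangentSpace I y) (x : M) {z : E}
    (hz : z ∈ (extChartAt I x).target) :
    VectorField.mpullbackWithin 𝓘(ℝ, E) I (extChartAt I x).symm V (range I) z =
      mvfderiv I (extChartAt I x) ((extChartAt I x).symm z) (V ((extChartAt I x).symm z)) := by
  rw [VectorField.mpullbackWithin_apply, ContinuousLinearMap.inverse_eq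
    (mfderivWithin_extChartAt_symm_comp_mfderiv_extChartAt hz)
    (mfderiv_extChartAt_comp_mfderivWithin_extChartAt_symm hz)]
  rfl

lemma trivializationAt_snd_eq_mvfderiv {x y : M} (hy : y ∈ (chartAt H x).source)
    (u : TangentSpace I y) :
    (trivializationAt E (fun x : M ↦ TangentSpace I x) x ⟨y, u⟩).2 =
      mvfderiv I (extChartAt I x) y u := by
  have h := DFunLike.congr_fun
    (TangentBundle.continuousLinearMapAt_trivializationAt (I := I) hy) u
  refine Eq.trans ?_ h
  rw [Trivialization.continuousLinearMapAt_apply, Trivialization.linearMapAt_apply, if_pos]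
  simpa using hy

/-- The bundle trivialization at `x` is the differential of the chart at `x`, so
`FiberBundle.extend` has constant coefficients in that chart: it is a coordinate field. -/
lemma mvfderiv_extChartAt_extend {x y : M} (hy : y ∈ (chartAt H x).source)
    (u : TangentSpace I x) :
    mvfderiv I (extChartAt I x) y (FiberBundle.extend E u y) = u := by
  rw [← trivializationAt_snd_eq_mvfderiv hy, FiberBundle.extend,
    Trivialization.apply_mk_symm _ (by simpa using hy)]
  exact trivializationAt_self_snd x u

omit [IsManifold I 1 M] in
lemma mlieBracket_eq_zero_of_extChartAt [I.Boundaryless] {x : M} {V W : ∀ y : M, TangentSpace I y}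
    {V' W' : E → E}
    (hV : VectorField.mpullbackWithin 𝓘(ℝ, E) I (extChartAt I x).symm V (range I)
      =ᶠ[nhds (extChartAt I x x)] V')
    (hW : VectorField.mpullbackWithin 𝓘(ℝ, E) I (extChartAt I x).symm W (range I)
      =ᶠ[nhds (extChartAt I x x)] W')
    (h₀ : VectorField.lieBracket ℝ V' W' (extChartAt I x x) = 0) :
    VectorField.mlieBracket I V W x = 0 := by
  have h := hV.lieBracket_vectorField_eq (𝕜 := ℝ) hW
  have hu : (extChartAt I x).symm ⁻¹' univ ∩ range I = univ := by simp [I.range_eq_univ]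
  rw [← VectorField.mlieBracketWithin_univ, VectorField.mlieBracketWithin_apply, hu]
  exact (congrArg _ ((congrFun (VectorField.lieBracketWithin_univ (𝕜 := ℝ)) _).trans
    (h.trans h₀))).trans (map_zero _)

lemma mlieBracket_extend (x : M) [I.Boundaryless] (u v : TangentSpace I x) :
    VectorField.mlieBracket I (FiberBundle.extend E u) (FiberBundle.extend E v) x = 0 := by
  have key (w : TangentSpace I x) :
      VectorField.mpullbackWithin 𝓘(ℝ, E) I (extChartAt I x).symm (FiberBundle.extend E w) (range I)
        =ᶠ[nhds (extChartAt I x x)] fun _ ↦ (w : E) := by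
    filter_upwards [extChartAt_target_mem_nhds (I := I) x] with z hz
    rw [mpullbackWithin_extChartAt_symm _ _ hz]
    exact mvfderiv_extChartAt_extend (by simpa using (extChartAt I x).map_target hz) w
  exact mlieBracket_eq_zero_of_extChartAt (key u) (key v) (lieBracket_const (E := E) u v _)

lemma mvfderiv_eq_of_eventuallyEq_comp_extChartAt {x y : M} (hy : y ∈ (chartAt H x).source)
    {f : M → F} {h : E → F} (hf : f =ᶠ[nhds y] h ∘ extChartAt I x)
    (hh : DifferentiableAt ℝ h (extChartAt I x y)) (u : TangentSpace I y) :
    mvfderiv I f y u = fderiv ℝ h (extChartAt I x y) (mvfderiv I (extChartAt I x) y u) := by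
  have h₁ := (hh.hasFDerivAt.hasMFDerivAt).comp y
    (mdifferentiableAt_extChartAt (I := I) hy).hasMFDerivAt
  have h₂ := (h₁.congr_of_eventuallyEq hf).mfderiv
  exact DFunLike.congr_fun h₂ u

omit [IsManifold I 1 M] in
lemma contDiffAt_comp_extChartAt_symm [I.Boundaryless] {n : WithTop ℕ∞} {x : M} {f : M → F}
    (hf : ContMDiffAt I 𝓘(ℝ, F) n f x) :
    ContDiffAt ℝ n (f ∘ (extChartAt I x).symm) (extChartAt I x x) := by
  have h := (contMDiffAt_iff.1 hf).2
  rw [I.range_eq_univ, contDiffWithinAt_univ] at h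
  exact h

lemma eventually_mvfderiv_extend [I.Boundaryless] {x : M} {f : M → F}
    (hf : ContMDiffAt I 𝓘(ℝ, F) 2 f x) (v : TangentSpace I x) :
    (fun y ↦ mvfderiv I f y (FiberBundle.extend E v y)) =ᶠ[nhds x]
      (fun z ↦ fderiv ℝ (f ∘ (extChartAt I x).symm) z v) ∘ extChartAt I x := by
  have h := contDiffAt_comp_extChartAt_symm hf
  have h' : ∀ᶠ z in nhds (extChartAt I x x),
      DifferentiableAt ℝ (f ∘ (extChartAt I x).symm) z :=
    (h.eventually (by simp)).mono fun z hz ↦ hz.differentiableAt (by simp)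
  filter_upwards [(continuousAt_extChartAt (I := I) x).eventually h',
    (chartAt H x).open_source.mem_nhds (mem_chart_source H x)] with y hy hy'
  rw [mvfderiv_eq_of_eventuallyEq_comp_extChartAt hy' _ hy, mvfderiv_extChartAt_extend hy']
  · rfl
  · filter_upwards [(chartAt H x).open_source.mem_nhds hy'] with z hz
    simp only [Function.comp_apply]
    rw [(extChartAt I x).left_inv (by simpa using hz)]

lemma mvfderiv_extChartAt_self (x : M) (u : TangentSpace I x) :
    mvfderiv I (extChartAt I x) x u = u := by
  have := mvfderiv_extChartAt_extend (I := I) (mem_chart_source H x) u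
  rwa [FiberBundle.extend_apply_self] at this

lemma differentiableAt_fderiv_apply {h : E → F} {c : E} (hh : ContDiffAt ℝ 2 h c) (v : E) :
    HasFDerivAt (fun z ↦ fderiv ℝ h z v)
      ((ContinuousLinearMap.apply ℝ F v).comp (fderiv ℝ (fderiv ℝ h) c)) c :=
  (ContinuousLinearMap.apply ℝ F v).hasFDerivAt.comp c
    ((hh.fderiv_right (m := 1) (by norm_num)).differentiableAt one_ne_zero).hasFDerivAt

lemma mdifferentiableAt_mvfderiv_extend [I.Boundaryless] {x : M} {f : M → F}
    (hf : ContMDiffAt I 𝓘(ℝ, F) 2 f x) (v : TangentSpace I x) :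
    MDifferentiableAt I 𝓘(ℝ, F) (fun y ↦ mvfderiv I f y (FiberBundle.extend E v y)) x := by
  refine MDifferentiableAt.congr_of_eventuallyEq ?_ (eventually_mvfderiv_extend hf v)
  exact (differentiableAt_fderiv_apply (contDiffAt_comp_extChartAt_symm hf)
    v).differentiableAt.comp_mdifferentiableAt
      (mdifferentiableAt_extChartAt (mem_chart_source H x))

/-- Second derivatives along two coordinate vector fields commute. -/
lemma mvfderiv_mvfderiv_extend_comm [I.Boundaryless] {x : M} {f : M → F}
    (hf : ContMDiffAt I 𝓘(ℝ, F) 2 f x) (u v : TangentSpace I x) :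
    mvfderiv I (fun y ↦ mvfderiv I f y (FiberBundle.extend E v y)) x u =
      mvfderiv I (fun y ↦ mvfderiv I f y (FiberBundle.extend E u y)) x v := by
  have key (u v : TangentSpace I x) :
      mvfderiv I (fun y ↦ mvfderiv I f y (FiberBundle.extend E v y)) x u =
        fderiv ℝ (fderiv ℝ (f ∘ (extChartAt I x).symm)) (extChartAt I x x) u v := by
    have h := differentiableAt_fderiv_apply (contDiffAt_comp_extChartAt_symm hf) (v : E)
    rw [mvfderiv_eq_of_eventuallyEq_comp_extChartAt (mem_chart_source H x)
      (eventually_mvfderiv_extend hf v) h.differentiableAt, mvfderiv_extChartAt_self, h.fderiv]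
    rfl
  rw [key, key]
  exact (contDiffAt_comp_extChartAt_symm hf).isSymmSndFDerivAt (by simp) u v

end Charts

/-! ### Left-invariant and right-invariant fields commute -/

section InvariantFields

variable {E : Type*} [NormedAddCommGroup E] [NormedSpace ℝ E]
  {H : Type*} [TopologicalSpace H] {I : ModelWithCorners ℝ E H}
  {G : Type*} [TopologicalSpace G] [ChartedSpace H G] [Group G] [LieGroup I ∞ G]

variable (I G) in
/-- The multiplication of `G`, read in the chart at the identity. -/
def chartMul (p : E × E) : E :=
  extChartAt I (1 : G) ((extChartAt I (1 : G)).symm p.1 * (extChartAt I (1 : G)).symm p.2)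

lemma contDiffAt_chartMul [I.Boundaryless] :
    ContDiffAt ℝ 2 (chartMul I G) (extChartAt I (1 : G) 1, extChartAt I (1 : G) 1) := by
  have hs : ContMDiffAt 𝓘(ℝ, E) I ∞ (extChartAt I (1 : G)).symm (extChartAt I (1 : G) 1) :=
    (contMDiffOn_extChartAt_symm (1 : G)).contMDiffAt (extChartAt_target_mem_nhds 1)
  have h₁ : ContMDiffAt 𝓘(ℝ, E × E) I ∞ (fun p : E × E ↦ (extChartAt I (1 : G)).symm p.1)
      (extChartAt I (1 : G) 1, extChartAt I (1 : G) 1) :=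
    ContMDiffAt.comp _ hs contDiff_fst.contDiffAt.contMDiffAt
  have h₂ : ContMDiffAt 𝓘(ℝ, E × E) I ∞ (fun p : E × E ↦ (extChartAt I (1 : G)).symm p.2)
      (extChartAt I (1 : G) 1, extChartAt I (1 : G) 1) :=
    ContMDiffAt.comp _ hs contDiff_snd.contDiffAt.contMDiffAt
  have h₃ := (contMDiffAt_extChartAt' (I := I) (n := ∞) (x := (1 : G)) (x' := 1)
    (mem_chart_source H 1)).comp_of_eq (h₁.mul h₂) (by simp)
  exact (h₃.contDiffAt).of_le (WithTop.coe_le_coe.2 le_top)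

lemma eventually_chartMul_mul [I.Boundaryless] :
    ∀ᶠ x in nhds (extChartAt I (1 : G) 1), x ∈ (extChartAt I (1 : G)).target ∧ 
      ContDiffAt ℝ 2 (chartMul I G) (x, extChartAt I (1 : G) 1) ∧
      ContDiffAt ℝ 2 (chartMul I G) (extChartAt I (1 : G) 1, x) := by
  have h := (contDiffAt_chartMul (I := I) (G := G)).eventually (by simp)
  filter_upwards [extChartAt_target_mem_nhds (I := I) (1 : G),
    (Continuous.prodMk_left (extChartAt I (1 : G) 1)).continuousAt.eventually h,
    (Continuous.prodMk_right (extChartAt I (1 : G) 1)).continuousAt.eventually h] with x h₁ h₂ h₃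
  exact ⟨h₁, h₂, h₃⟩

/-- Chain rule for `y ↦ a * y` read in the chart at the identity; it brings left-invariant fields
into the form of `lieBracket_partial_fderiv_eq_zero`. -/
lemma mvfderiv_extChartAt_dL {x : E} (hx : x ∈ (extChartAt I (1 : G)).target)
    (h : ContDiffAt ℝ 2 (chartMul I G) (x, extChartAt I (1 : G) 1)) (v : E) :
    mvfderiv I (extChartAt I (1 : G)) ((extChartAt I (1 : G)).symm x)
      (dL I ((extChartAt I (1 : G)).symm x) 1 v) =
      fderiv ℝ (chartMul I G) (x, extChartAt I (1 : G) 1) (0, v) := by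
  set a := (extChartAt I (1 : G)).symm x with ha
  have has : a ∈ (chartAt H (1 : G)).source := by
    simpa [ha] using (extChartAt I (1 : G)).map_target hx
  have hd : HasFDerivAt (fun y ↦ chartMul I G (x, y))
      ((fderiv ℝ (chartMul I G) (x, extChartAt I (1 : G) 1)).comp
        (ContinuousLinearMap.inr ℝ E E)) (extChartAt I (1 : G) 1) :=
    HasFDerivAt.comp _ (h.differentiableAt (by simp)).hasFDerivAt (hasFDerivAt_prodMk_right _ _)
  have he : (extChartAt I (1 : G)) ∘ (fun y ↦ a * y) =ᶠ[nhds (1 : G)]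
      (fun y ↦ chartMul I G (x, y)) ∘ extChartAt I (1 : G) := by
    filter_upwards [(chartAt H (1 : G)).open_source.mem_nhds (mem_chart_source H 1)] with z hz
    simp only [Function.comp_apply, chartMul]
    rw [(extChartAt I (1 : G)).left_inv (by simpa using hz)]
  have h₁ := mvfderiv_eq_of_eventuallyEq_comp_extChartAt (mem_chart_source H (1 : G)) he
    hd.differentiableAt (v : TangentSpace I (1 : G))
  rw [hd.fderiv] at h₁
  have h₂ := mfderiv_comp_of_eq (I := I) (I' := I) (I'' := 𝓘(ℝ, E)) (x := (1 : G))
    (f := fun y ↦ a * y) (y := a)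
    (mdifferentiableAt_extChartAt (I := I) has) (mdifferentiableAt_mulLeft a 1) (mul_one a)
  exact (mvfderiv_congr_point (mul_one a).symm _).trans ((DFunLike.congr_fun h₂ v).symm.trans (h₁.trans
    (congrArg _ (mvfderiv_extChartAt_self (I := I) (1 : G) v))))

lemma mvfderiv_extChartAt_dR {x : E} (hx : x ∈ (extChartAt I (1 : G)).target)
    (h : ContDiffAt ℝ 2 (chartMul I G) (extChartAt I (1 : G) 1, x)) (v : E) :
    mvfderiv I (extChartAt I (1 : G)) ((extChartAt I (1 : G)).symm x)
      (dR I ((extChartAt I (1 : G)).symm x) 1 v) =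
      fderiv ℝ (chartMul I G) (extChartAt I (1 : G) 1, x) (v, 0) := by
  set a := (extChartAt I (1 : G)).symm x with ha
  have has : a ∈ (chartAt H (1 : G)).source := by
    simpa [ha] using (extChartAt I (1 : G)).map_target hx
  have hd : HasFDerivAt (fun y ↦ chartMul I G (y, x))
      ((fderiv ℝ (chartMul I G) (extChartAt I (1 : G) 1, x)).comp
        (ContinuousLinearMap.inl ℝ E E)) (extChartAt I (1 : G) 1) :=
    HasFDerivAt.comp (f := fun y ↦ (y, x)) _ (h.differentiableAt (by simp)).hasFDerivAt
      (hasFDerivAt_prodMk_left _ _)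
  have he : (extChartAt I (1 : G)) ∘ (fun y ↦ y * a) =ᶠ[nhds (1 : G)]
      (fun y ↦ chartMul I G (y, x)) ∘ extChartAt I (1 : G) := by
    filter_upwards [(chartAt H (1 : G)).open_source.mem_nhds (mem_chart_source H 1)] with z hz
    simp only [Function.comp_apply, chartMul]
    rw [(extChartAt I (1 : G)).left_inv (by simpa using hz)]
  have h₁ := mvfderiv_eq_of_eventuallyEq_comp_extChartAt (mem_chart_source H (1 : G)) he
    hd.differentiableAt (v : TangentSpace I (1 : G))
  rw [hd.fderiv] at h₁
  have h₂ := mfderiv_comp_of_eq (I := I) (I' := I) (I'' := 𝓘(ℝ, E)) (x := (1 : G))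
    (f := fun y ↦ y * a) (y := a)
    (mdifferentiableAt_extChartAt (I := I) has) (mdifferentiableAt_mulRight a 1) (one_mul a)
  exact (mvfderiv_congr_point (one_mul a).symm _).trans ((DFunLike.congr_fun h₂ v).symm.trans (h₁.trans
    (congrArg _ (mvfderiv_extChartAt_self (I := I) (1 : G) v))))

variable (I G) in
/-- The left-invariant vector field with value `v` at the identity. -/
def leftField (v : E) (g : G) : TangentSpace I g := dL I g 1 v

variable (I G) in
/-- The right-invariant vector field with value `w` at the identity. -/
def rightField (w : E) (g : G) : TangentSpace I g := dR I g 1 w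

/-- Left-invariant and right-invariant vector fields commute. -/
lemma mlieBracket_leftInvariant_rightInvariant [I.Boundaryless] (v w : E) :
    VectorField.mlieBracket I (leftField I G v)
      (rightField I G w) 1 = 0 := by
  have keyL : VectorField.mpullbackWithin 𝓘(ℝ, E) I (extChartAt I (1 : G)).symm
      (leftField I G v) (range I) =ᶠ[nhds (extChartAt I (1 : G) 1)]
      fun x ↦ fderiv ℝ (chartMul I G) (x, extChartAt I (1 : G) 1) (0, v) := by
    filter_upwards [eventually_chartMul_mul (I := I) (G := G)] with x hx
    rw [mpullbackWithin_extChartAt_symm _ _ hx.1]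
    exact mvfderiv_extChartAt_dL hx.1 hx.2.1 v
  have keyR : VectorField.mpullbackWithin 𝓘(ℝ, E) I (extChartAt I (1 : G)).symm
      (rightField I G w) (range I) =ᶠ[nhds (extChartAt I (1 : G) 1)]
      fun x ↦ fderiv ℝ (chartMul I G) (extChartAt I (1 : G) 1, x) (w, 0) := by
    filter_upwards [eventually_chartMul_mul (I := I) (G := G)] with x hx
    rw [mpullbackWithin_extChartAt_symm _ _ hx.1]
    exact mvfderiv_extChartAt_dR hx.1 hx.2.2 w
  have hc := (eventually_chartMul_mul (I := I) (G := G)).self_of_nhds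
  -- At the identity both partial derivatives of the multiplication are the identity map, as
  -- translation by `1` is trivial.
  have h1 : (extChartAt I (1 : G)).symm (extChartAt I (1 : G) 1) = 1 := extChartAt_to_inv 1
  have hv := mvfderiv_extChartAt_dL hc.1 hc.2.1 v
  have hw := mvfderiv_extChartAt_dR hc.1 hc.2.2 w
  rw [h1, dL_one] at hv
  rw [h1, dR_one] at hw
  have h₀ := lieBracket_partial_fderiv_eq_zero hc.2.1
    (hv.symm.trans (mvfderiv_extChartAt_self (I := I) (1 : G) v))
    (hw.symm.trans (mvfderiv_extChartAt_self (I := I) (1 : G) w))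
  exact mlieBracket_eq_zero_of_extChartAt keyL keyR h₀

end InvariantFields

/-! ### The bracket of the Lie algebra as a continuous bilinear map -/

section LieAlgebra

variable {E : Type*} [NormedAddCommGroup E] [NormedSpace ℝ E]
  {H : Type*} [TopologicalSpace H] {I : ModelWithCorners ℝ E H}
  {G : Type*} [TopologicalSpace G] [ChartedSpace H G] [Group G] [LieGroup I ∞ G]

variable (I G) in
lemma lieGroup_minSmoothness : LieGroup I (minSmoothness ℝ 3) G :=
  LieGroup.of_le (n := ∞) (by
    rw [minSmoothness_of_isRCLikeNormedField]
    exact WithTop.coe_le_coe.2 le_top)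

omit [LieGroup I ∞ G] in
lemma leftField_one (v : E) : leftField I G v 1 = v := dL_one 1 v

omit [LieGroup I ∞ G] in
lemma rightField_one (v : E) : rightField I G v 1 = v := dR_one 1 v

lemma contMDiff_leftField (v : E) :
    ContMDiff I I.tangent ∞ (fun g : G ↦ (⟨g, leftField I G v g⟩ : TangentBundle I G)) :=
  contMDiff_leftPush.comp (contMDiff_id.prodMk contMDiff_const)

lemma mdifferentiableAt_leftField (v : E) (g : G) :
    MDifferentiableAt I I.tangent
      (fun g : G ↦ (⟨g, leftField I G v g⟩ : TangentBundle I G)) g :=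
  (contMDiff_leftField v).contMDiffAt.mdifferentiableAt (by simp)

lemma mdifferentiableAt_rightField (v : E) (g : G) :
    MDifferentiableAt I I.tangent
      (fun g : G ↦ (⟨g, rightField I G v g⟩ : TangentBundle I G)) g :=
  (contMDiff_rightPush v).contMDiffAt.mdifferentiableAt (by simp)

variable [CompleteSpace E] [FiniteDimensional ℝ E]

variable (I G) in
/-- The bracket of the Lie algebra of `G`, as a bilinear map on the model space. -/
def bracketCLM : E →L[ℝ] E →L[ℝ] E :=
  haveI := lieGroup_minSmoothness I G
  LinearMap.toContinuousBilinearMap <|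
    LinearMap.mk₂ ℝ (fun u v : E ↦ (Bracket.bracket (L := GroupLieAlgebra I G) (M := GroupLieAlgebra I G) u v : E))
      (fun u v w ↦ add_lie (L := GroupLieAlgebra I G) (M := GroupLieAlgebra I G) u v w)
      (fun c u w ↦ smul_lie (R := ℝ) (L := GroupLieAlgebra I G) (M := GroupLieAlgebra I G) c u w)
      (fun u v w ↦ lie_add (L := GroupLieAlgebra I G) (M := GroupLieAlgebra I G) u v w)
      (fun c u w ↦ lie_smul (R := ℝ) (L := GroupLieAlgebra I G) (M := GroupLieAlgebra I G) c u w)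

lemma bracketCLM_self (u : E) : bracketCLM I G u u = 0 :=
  haveI := lieGroup_minSmoothness I G
  lie_self (L := GroupLieAlgebra I G) u

lemma bracketCLM_swap (u v : E) : bracketCLM I G u v = -bracketCLM I G v u :=
  haveI := lieGroup_minSmoothness I G
  (lie_skew (L := GroupLieAlgebra I G) u v).symm

lemma bracketCLM_jacobi (u v w : E) : bracketCLM I G u (bracketCLM I G v w) =
    bracketCLM I G (bracketCLM I G u v) w + bracketCLM I G v (bracketCLM I G u w) :=
  haveI := lieGroup_minSmoothness I G
  leibniz_lie (L₁ := GroupLieAlgebra I G) (L₂ := GroupLieAlgebra I G) (M := GroupLieAlgebra I G) u v w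

lemma mlieBracket_leftField (u v : E) (g : G) :
    VectorField.mlieBracket I (leftField I G u) (leftField I G v) g =
      leftField I G (bracketCLM I G u v) g :=
  haveI := lieGroup_minSmoothness I G
  (congrFun (mulInvariantVector_mlieBracket (I := I) (G := G) u v) g).symm

end LieAlgebra

/-! ### Ad-invariance and the connection on left-invariant fields -/

section Metric

variable {E : Type*} [NormedAddCommGroup E] [NormedSpace ℝ E]
  {H : Type*} [TopologicalSpace H] {I : ModelWithCorners ℝ E H}
  {G : Type*} [TopologicalSpace G] [ChartedSpace H G]
  [RiemannianBundle (fun x : G ↦ TangentSpace I x)]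

variable (I) in
/-- The metric at `g`, as a function on the model space. -/
def metric (g : G) (u v : E) : ℝ := inner ℝ (E := TangentSpace I g) u v

lemma metric_comm (g : G) (u v : E) : metric I g u v = metric I g v u :=
  real_inner_comm (F := TangentSpace I g) v u

lemma metric_add_left (g : G) (u v w : E) :
    metric I g (u + v) w = metric I g u w + metric I g v w :=
  inner_add_left (E := TangentSpace I g) u v w

lemma metric_smul_left (g : G) (c : ℝ) (u v : E) :
    metric I g (c • u) v = c * metric I g u v :=
  real_inner_smul_left (F := TangentSpace I g) u v c

lemma metric_sub_left (g : G) (u v w : E) :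
    metric I g (u - v) w = metric I g u w - metric I g v w :=
  inner_sub_left (E := TangentSpace I g) u v w

lemma eq_of_metric_eq {g : G} {u v : E} (h : ∀ w, metric I g u w = metric I g v w) : u = v :=
  ext_inner_right ℝ (E := TangentSpace I g) h

variable [Group G]

lemma metric_dL (hbi : IsBiInvariantMetric I G) (a x : G) (u v : E) :
    metric I (a * x) (dL I a x u) (dL I a x v) = metric I x u v := hbi.1 a x u v

lemma metric_dR (hbi : IsBiInvariantMetric I G) (a x : G) (u v : E) :
    metric I (x * a) (dR I a x u) (dR I a x v) = metric I x u v := hbi.2 a x u v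

lemma metric_leftField (hbi : IsBiInvariantMetric I G) (g : G) (u v : E) :
    metric I g (leftField I G u g) (leftField I G v g) = metric I (1 : G) u v := by
  have := metric_dL hbi g 1 u v
  rwa [mul_one] at this

lemma metric_rightField (hbi : IsBiInvariantMetric I G) (g : G) (u v : E) :
    metric I g (rightField I G u g) (rightField I G v g) = metric I (1 : G) u v := by
  have := metric_dR hbi g 1 u v
  rwa [one_mul] at this

variable [CompleteSpace E] [FiniteDimensional ℝ E] [LieGroup I ∞ G]
  [IsContMDiffRiemannianBundle I ∞ E (fun x : G ↦ TangentSpace I x)]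
  {cov : CovariantDerivative I E (fun x : G ↦ TangentSpace I x)}

lemma metric_cov_add_eq_zero (hcov : IsLeviCivita cov) {X Y : ∀ g : G, TangentSpace I g} {g : G}
    (hX : MDifferentiableAt I I.tangent (fun g ↦ (⟨g, X g⟩ : TangentBundle I G)) g)
    (hY : MDifferentiableAt I I.tangent (fun g ↦ (⟨g, Y g⟩ : TangentBundle I G)) g) {c : ℝ}
    (h : ∀ g, metric I g (X g) (Y g) = c) (u : TangentSpace I g) :
    metric I g (cov X g u) (Y g) + metric I g (cov Y g u) (X g) = 0 := by
  have h₁ := hcov.2.mvfderiv_inner_eq (FiberBundle.extend E u) hX hY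
  have h₂ : (fun g ↦ inner ℝ (X g) (Y g)) = fun _ : G ↦ c := funext h
  rw [h₂, mvfderiv_const] at h₁
  simp only [FiberBundle.extend_apply_self] at h₁
  exact (congrArg (_ + ·) (metric_comm (I := I) g _ _)).trans h₁.symm

lemma cov_sub_cov (hcov : IsLeviCivita cov) {X Y : ∀ g : G, TangentSpace I g} {g : G}
    (hX : MDifferentiableAt I I.tangent (fun g ↦ (⟨g, X g⟩ : TangentBundle I G)) g)
    (hY : MDifferentiableAt I I.tangent (fun g ↦ (⟨g, Y g⟩ : TangentBundle I G)) g) :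
    cov Y g (X g) - cov X g (Y g) = VectorField.mlieBracket I X Y g :=
  (CovariantDerivative.torsion_eq_zero_iff cov).1 hcov.1 hX hY

lemma metric_cov_leftField_antisymm (hbi : IsBiInvariantMetric I G) (hcov : IsLeviCivita cov)
    (g : G) (u v w : E) :
    metric I g (cov (leftField I G v) g (leftField I G u g)) (leftField I G w g) =
      -metric I g (cov (leftField I G w) g (leftField I G u g)) (leftField I G v g) := by
  have h := metric_cov_add_eq_zero hcov (mdifferentiableAt_leftField v g)
    (mdifferentiableAt_leftField w g) (fun g ↦ metric_leftField hbi g v w) (leftField I G u g)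
  linarith

lemma metric_cov_leftField_sub (hbi : IsBiInvariantMetric I G) (hcov : IsLeviCivita cov)
    (g : G) (u v w : E) :
    metric I g (cov (leftField I G v) g (leftField I G u g)) (leftField I G w g) -
      metric I g (cov (leftField I G u) g (leftField I G v g)) (leftField I G w g) =
      metric I (1 : G) (bracketCLM I G u v) w := by
  have h := cov_sub_cov hcov (mdifferentiableAt_leftField u g) (mdifferentiableAt_leftField v g)
  rw [mlieBracket_leftField] at h
  rw [← metric_leftField hbi g, ← h]
  exact (metric_sub_left g _ _ _).symm

/-- Let `R_u` be right-invariant and `L_z` left-invariant. The constant length of `R_u` gives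
`⟨∇_{L_z} R_u, R_u⟩ = 0`, and since the two fields commute at `1`, `∇_{L_z} R_u = ∇_{R_u} L_z`
there. So `⟨∇_u L_z, u⟩ = 0`; the constant length of `L_u` gives `⟨∇_z L_u, u⟩ = 0`, and the
difference of the two is `⟨[u, z], u⟩`. -/
lemma metric_bracket_self [I.Boundaryless] (hbi : IsBiInvariantMetric I G)
    (hcov : IsLeviCivita cov) (u z : E) : metric I (1 : G) (bracketCLM I G u z) u = 0 := by
  have h₁ := metric_cov_add_eq_zero hcov (mdifferentiableAt_rightField u (1 : G))
    (mdifferentiableAt_rightField u (1 : G)) (fun g ↦ metric_rightField hbi g u u)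
    (leftField I G z 1)
  have h₂ := cov_sub_cov hcov (mdifferentiableAt_leftField z (1 : G))
    (mdifferentiableAt_rightField u (1 : G))
  rw [mlieBracket_leftInvariant_rightInvariant, sub_eq_zero] at h₂
  rw [h₂] at h₁
  have h₃ := metric_cov_leftField_antisymm hbi hcov 1 z u u
  have h₄ := metric_cov_leftField_sub hbi hcov 1 u z u
  have e : rightField I G u 1 = leftField I G u 1 := (rightField_one u).trans (leftField_one u).symm
  rw [e] at h₁
  linarith

/-- Polarization of `metric_bracket_self` in `u + w`. -/
lemma metric_bracket_cyclic [I.Boundaryless] (hbi : IsBiInvariantMetric I G)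
    (hcov : IsLeviCivita cov) (u v w : E) :
    metric I (1 : G) (bracketCLM I G u v) w = metric I (1 : G) (bracketCLM I G v w) u := by
  have h := metric_bracket_self hbi hcov (u + w) v
  have hu := metric_bracket_self hbi hcov u v
  have hw := metric_bracket_self hbi hcov w v
  rw [map_add, add_apply, metric_add_left, metric_comm 1 _ (u + w),
    metric_comm 1 _ (u + w), metric_add_left, metric_add_left, metric_comm 1 u, metric_comm 1 u,
    metric_comm 1 w, metric_comm 1 w, hu, hw, bracketCLM_swap w v,
    ← neg_one_smul ℝ, metric_smul_left] at h
  linarith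

/-- The Levi-Civita connection of a bi-invariant metric on left-invariant vector fields. -/
lemma cov_leftField [I.Boundaryless] (hbi : IsBiInvariantMetric I G)
    (hcov : IsLeviCivita cov) (g : G) (u v : E) :
    cov (leftField I G v) g (leftField I G u g) =
      leftField I G ((1 / 2 : ℝ) • bracketCLM I G u v) g := by
  refine eq_of_metric_eq (I := I) (g := g) fun x ↦ ?_
  obtain ⟨w, rfl⟩ : ∃ w, leftField I G w g = x := ⟨dL I g⁻¹ g x, dL_dL_inv g x⟩
  rw [metric_leftField hbi, metric_smul_left]
  -- Koszul argument: three torsion identities and three compatibility identities determine `⟨∇_u v,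
  -- w⟩` in terms of brackets, and cyclic invariance makes the three bracket terms equal.
  have h₁ := metric_cov_leftField_sub hbi hcov g u v w
  have h₂ := metric_cov_leftField_sub hbi hcov g v w u
  have h₃ := metric_cov_leftField_sub hbi hcov g w u v
  have a₁ := metric_cov_leftField_antisymm hbi hcov g u v w
  have a₂ := metric_cov_leftField_antisymm hbi hcov g v w u
  have a₃ := metric_cov_leftField_antisymm hbi hcov g w u v
  have c₁ := metric_bracket_cyclic hbi hcov u v w
  have c₂ := metric_bracket_cyclic hbi hcov v w u
  linarith

lemma gConnection_eq [I.Boundaryless] (hbi : IsBiInvariantMetric I G)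
    (hcov : IsLeviCivita cov) (u v : GroupLieAlgebra I G) :
    gConnection cov u v = (1 / 2 : ℝ) • ⁅u, v⁆ :=
  (cov_leftField hbi hcov (1 : G) u v).trans (leftField_one _)

end Metric

/-! ### The connection in the left trivialization -/

section LeftTrivialization

variable {E : Type*} [NormedAddCommGroup E] [NormedSpace ℝ E]
  {H : Type*} [TopologicalSpace H] {I : ModelWithCorners ℝ E H}
  {G : Type*} [TopologicalSpace G] [ChartedSpace H G]
  {F₁ F₂ F₃ : Type*} [NormedAddCommGroup F₁] [NormedSpace ℝ F₁] [NormedAddCommGroup F₂]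
  [NormedSpace ℝ F₂] [NormedAddCommGroup F₃] [NormedSpace ℝ F₃]

lemma mvfderiv_congr {f f' : G → F₁} {g : G} (h : f =ᶠ[nhds g] f') (u : TangentSpace I g) :
    mvfderiv I f g u = mvfderiv I f' g u :=
  DFunLike.congr_fun (h.mfderiv_eq (I := I) (I' := 𝓘(ℝ, F₁))) u

lemma hasMFDerivAt_bilinear (B : F₁ →L[ℝ] F₂ →L[ℝ] F₃) {f : G → F₁} {h : G → F₂} {g : G}
    (hf : MDifferentiableAt I 𝓘(ℝ, F₁) f g) (hh : MDifferentiableAt I 𝓘(ℝ, F₂) h g) :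
    HasMFDerivAt I 𝓘(ℝ, F₃) (fun y ↦ B (f y) (h y)) g
      (B.precompR E (f g) (mvfderiv I h g) + B.precompL E (mvfderiv I f g) (h g)) := by
  refine ⟨(B.continuous.continuousAt.comp hf.continuousAt).clm_apply hh.continuousAt, ?_⟩
  have h₁ : writtenInExtChartAt I 𝓘(ℝ, F₁) g f (extChartAt I g g) = f g :=
    congrArg f (extChartAt_to_inv g)
  have h₂ : writtenInExtChartAt I 𝓘(ℝ, F₂) g h (extChartAt I g g) = h g :=
    congrArg h (extChartAt_to_inv g)
  have h₃ := B.hasFDerivWithinAt_of_bilinear hf.hasMFDerivAt.2 hh.hasMFDerivAt.2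
  rw [h₁, h₂] at h₃
  exact h₃

lemma mvfderiv_bilinear (B : F₁ →L[ℝ] F₂ →L[ℝ] F₃) {f : G → F₁} {h : G → F₂} {g : G}
    (hf : MDifferentiableAt I 𝓘(ℝ, F₁) f g) (hh : MDifferentiableAt I 𝓘(ℝ, F₂) h g)
    (u : TangentSpace I g) :
    mvfderiv I (fun y ↦ B (f y) (h y)) g u =
      B (mvfderiv I f g u) (h g) + B (f g) (mvfderiv I h g u) :=
  (DFunLike.congr_fun (hasMFDerivAt_bilinear B hf hh).mfderiv u).trans (add_comm _ _)

variable [Group G]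

/-- A vector field in the left trivialization of the tangent bundle. -/
def leftHat (Z : ∀ g : G, TangentSpace I g) (g : G) : E := dL I g⁻¹ g (Z g)

variable [LieGroup I ∞ G]

lemma leftHat_leftField (v : E) (g : G) : leftHat (I := I) (leftField I G v) g = v :=
  dL_inv_dL (I := I) (E := E) g v

lemma leftField_leftHat (Z : ∀ g : G, TangentSpace I g) (g : G) :
    leftField I G (leftHat Z g) g = Z g :=
  dL_dL_inv (I := I) (E := E) g (Z g)

lemma contMDiffAt_leftHat {Z : ∀ g : G, TangentSpace I g} {g : G} {n : WithTop ℕ∞} (hn : n ≤ ∞)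
    (hZ : ContMDiffAt I I.tangent n (fun g ↦ (⟨g, Z g⟩ : TangentBundle I G)) g) :
    ContMDiffAt I 𝓘(ℝ, E) n (leftHat Z) g :=
  (contMDiff_leftPull.contMDiffAt.of_le hn).comp g hZ

lemma mdifferentiableAt_leftHat {Z : ∀ g : G, TangentSpace I g} {g : G}
    (hZ : MDifferentiableAt I I.tangent (fun g ↦ (⟨g, Z g⟩ : TangentBundle I G)) g) :
    MDifferentiableAt I 𝓘(ℝ, E) (leftHat Z) g :=
  (contMDiff_leftPull.contMDiffAt.mdifferentiableAt (by simp)).comp g hZ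

lemma mdifferentiableAt_of_leftHat {Z : ∀ g : G, TangentSpace I g} {g : G}
    (hZ : MDifferentiableAt I 𝓘(ℝ, E) (leftHat Z) g) :
    MDifferentiableAt I I.tangent (fun g ↦ (⟨g, Z g⟩ : TangentBundle I G)) g := by
  have h : MDifferentiableAt I I.tangent
      (fun g ↦ (⟨g, leftField I G (leftHat Z g) g⟩ : TangentBundle I G)) g :=
    MDifferentiableAt.comp g (contMDiff_leftPush.contMDiffAt.mdifferentiableAt (by simp))
      (mdifferentiableAt_id.prodMk hZ)
  simpa only [leftField_leftHat] using h

variable [CompleteSpace E] [FiniteDimensional ℝ E]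
  [RiemannianBundle (fun x : G ↦ TangentSpace I x)]
  [IsContMDiffRiemannianBundle I ∞ E (fun x : G ↦ TangentSpace I x)]
  {cov : CovariantDerivative I E (fun x : G ↦ TangentSpace I x)} [I.Boundaryless]

/-- The Levi-Civita connection of a bi-invariant metric in the left trivialization. -/
lemma dL_cov (hbi : IsBiInvariantMetric I G) (hcov : IsLeviCivita cov)
    {Z : ∀ g : G, TangentSpace I g} {g : G}
    (hZ : MDifferentiableAt I I.tangent (fun g ↦ (⟨g, Z g⟩ : TangentBundle I G)) g)
    (u : TangentSpace I g) :
    dL I g⁻¹ g (cov Z g u) =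
      mvfderiv I (leftHat Z) g u + (1 / 2 : ℝ) • bracketCLM I G (dL I g⁻¹ g u) (leftHat Z g) := by
  -- The difference of two derivations in `Z` is tensorial, because the Leibniz terms `df(u) Ẑ`
  -- cancel. It may thus be evaluated on the left-invariant field through `Z g`, for which `Ẑ` is
  -- constant.
  have ht : TensorialAt I E (fun Z : ∀ g : G, TangentSpace I g ↦
      dL I g⁻¹ g (cov Z g u) - mvfderiv I (leftHat Z) g u) g := by
    constructor
    · intro f Z hf hZ
      have e : leftHat (f • Z) = fun y ↦ f y • leftHat Z y :=
        funext fun y ↦ map_smul (dL I y⁻¹ y) (f y) (Z y)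
      have h₁ : cov (f • Z) g u = f g • cov Z g u + mvfderiv I f g u • Z g :=
        DFunLike.congr_fun (cov.isCovariantDerivativeOn.leibniz (s := univ) hZ hf) u
      have h₂ : mvfderiv I (fun y ↦ f y • leftHat Z y) g u =
          f g • mvfderiv I (leftHat Z) g u + mvfderiv I f g u • leftHat Z g :=
        DFunLike.congr_fun (mvfderiv_smul hf (mdifferentiableAt_leftHat hZ)) u
      have h₃ : dL I g⁻¹ g (f g • cov Z g u + mvfderiv I f g u • Z g) =
          f g • dL I g⁻¹ g (cov Z g u) + mvfderiv I f g u • leftHat Z g := by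
        refine (map_add (dL I g⁻¹ g) _ _).trans ?_
        exact congrArg₂ _ (map_smul (dL I g⁻¹ g) _ _) (map_smul (dL I g⁻¹ g) _ _)
      rw [h₁, e, h₂, h₃]
      module
    · intro Z Z' hZ hZ'
      have e : leftHat (Z + Z') = leftHat Z + leftHat Z' :=
        funext fun y ↦ map_add (dL I y⁻¹ y) (Z y) (Z' y)
      have h₁ : cov (Z + Z') g u = cov Z g u + cov Z' g u :=
        DFunLike.congr_fun (cov.isCovariantDerivativeOn.add (s := univ) hZ hZ') u
      have h₂ : mvfderiv I (leftHat Z + leftHat Z') g u =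
          mvfderiv I (leftHat Z) g u + mvfderiv I (leftHat Z') g u :=
        DFunLike.congr_fun
          (mvfderiv_add (mdifferentiableAt_leftHat hZ) (mdifferentiableAt_leftHat hZ')) u
      have h₃ : dL I g⁻¹ g (cov Z g u + cov Z' g u) =
          dL I g⁻¹ g (cov Z g u) + dL I g⁻¹ g (cov Z' g u) := map_add (dL I g⁻¹ g) _ _
      rw [h₁, e, h₂, h₃]
      module
  have hp := ht.pointwise hZ (mdifferentiableAt_leftField (leftHat Z g) g)
    (leftField_leftHat Z g).symm
  have hc : leftHat (leftField I G (leftHat Z g)) = fun _ ↦ leftHat Z g :=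
    funext (leftHat_leftField _)
  have hu : leftField I G (dL I g⁻¹ g u) g = u :=
    dL_dL_inv (I := I) (E := E) g u
  have h₀ := cov_leftField hbi hcov g (dL I g⁻¹ g u) (leftHat Z g)
  rw [hu] at h₀
  have h₁ : dL I g⁻¹ g (cov (leftField I G (leftHat Z g)) g u) =
      (1 / 2 : ℝ) • bracketCLM I G (dL I g⁻¹ g u) (leftHat Z g) :=
    (congrArg (dL I g⁻¹ g) h₀).trans (dL_inv_dL g _)
  beta_reduce at hp
  rw [h₁, hc, mvfderiv_const] at hp
  rw [sub_eq_iff_eq_add] at hp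
  rw [hp]
  simp [add_comm]

end LeftTrivialization

/-! ### Curvature of a bi-invariant metric -/

section Curvature

variable {E : Type*} [NormedAddCommGroup E] [NormedSpace ℝ E]
  {H : Type*} [TopologicalSpace H] {I : ModelWithCorners ℝ E H}
  {G : Type*} [TopologicalSpace G] [ChartedSpace H G] [Group G] [LieGroup I ∞ G]

lemma contMDiffAt_leftHat_extend {g : G} (u : TangentSpace I g) :
    ContMDiffAt I 𝓘(ℝ, E) 2 (leftHat (FiberBundle.extend E u)) g :=
  contMDiffAt_leftHat (WithTop.coe_le_coe.2 le_top) (FiberBundle.contMDiffAt_extend I E u)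

lemma mdifferentiableAt_leftHat_extend {g : G} (u : TangentSpace I g) :
    MDifferentiableAt I 𝓘(ℝ, E) (leftHat (FiberBundle.extend E u)) g :=
  (contMDiffAt_leftHat_extend u).mdifferentiableAt (by simp)

lemma leftHat_extend_self {g : G} (u : TangentSpace I g) :
    leftHat (FiberBundle.extend E u) g = dL I g⁻¹ g u :=
  congrArg (dL I g⁻¹ g) (FiberBundle.extend_apply_self E u)

variable [CompleteSpace E] [FiniteDimensional ℝ E] [I.Boundaryless]
  [RiemannianBundle (fun x : G ↦ TangentSpace I x)]
  [IsContMDiffRiemannianBundle I ∞ E (fun x : G ↦ TangentSpace I x)]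
  {cov : CovariantDerivative I E (fun x : G ↦ TangentSpace I x)}

/-- The second covariant derivative along coordinate vector fields in the left trivialization. -/
lemma dL_cov_cov_extend (hbi : IsBiInvariantMetric I G) (hcov : IsLeviCivita cov) {g : G}
    (u v w : TangentSpace I g) :
    dL I g⁻¹ g (cov (fun y ↦ cov (FiberBundle.extend E w) y (FiberBundle.extend E v y)) g u) =
      mvfderiv I (fun y ↦ mvfderiv I (leftHat (FiberBundle.extend E w)) y
        (FiberBundle.extend E v y)) g u +
      (1 / 2 : ℝ) • (bracketCLM I G (mvfderiv I (leftHat (FiberBundle.extend E v)) g u)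
          (dL I g⁻¹ g w) +
        bracketCLM I G (dL I g⁻¹ g v) (mvfderiv I (leftHat (FiberBundle.extend E w)) g u)) +
      (1 / 2 : ℝ) • bracketCLM I G (dL I g⁻¹ g u)
        (mvfderiv I (leftHat (FiberBundle.extend E w)) g v +
          (1 / 2 : ℝ) • bracketCLM I G (dL I g⁻¹ g v) (dL I g⁻¹ g w)) := by
  set X := FiberBundle.extend E v with hX
  set Z := FiberBundle.extend E w with hZ
  -- The formula for the first derivative is needed on a neighborhood of `g` in order to be
  -- differentiated again; the extended field is smooth only near `g`.
  have hW : leftHat (fun y ↦ cov Z y (X y)) =ᶠ[nhds g] fun y ↦ mvfderiv I (leftHat Z) y (X y) +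
      ((1 / 2 : ℝ) • bracketCLM I G) (leftHat X y) (leftHat Z y) := by
    have hs : ∀ᶠ y in nhds g, ContMDiffAt I I.tangent 1
        (fun g ↦ (⟨g, Z g⟩ : TangentBundle I G)) y :=
      (contMDiffAt_iff_contMDiffAt_nhds (n := 1) (by simp)).1
        (FiberBundle.contMDiffAt_extend I E w)
    filter_upwards [hs] with y hy
    exact dL_cov hbi hcov (hy.mdifferentiableAt one_ne_zero) (X y)
  have h₁ := mdifferentiableAt_mvfderiv_extend (contMDiffAt_leftHat_extend w) v
  have h₂ := (hasMFDerivAt_bilinear ((1 / 2 : ℝ) • bracketCLM I G)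
    (mdifferentiableAt_leftHat_extend v) (mdifferentiableAt_leftHat_extend w)).mdifferentiableAt
  have h₃ : MDifferentiableAt I 𝓘(ℝ, E) (leftHat (fun y ↦ cov Z y (X y))) g :=
    (h₁.add h₂).congr_of_eventuallyEq hW
  have h₄ := DFunLike.congr_fun (mvfderiv_add h₁ h₂) u
  have h₅ := mvfderiv_bilinear ((1 / 2 : ℝ) • bracketCLM I G)
    (mdifferentiableAt_leftHat_extend v) (mdifferentiableAt_leftHat_extend w) u
  have e : X g = v := FiberBundle.extend_apply_self E v
  have hg := hW.self_of_nhds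
  beta_reduce at hg
  rw [e, leftHat_extend_self v, leftHat_extend_self w] at hg
  rw [leftHat_extend_self v, leftHat_extend_self w] at h₅
  rw [dL_cov hbi hcov (mdifferentiableAt_of_leftHat h₃) u, mvfderiv_congr hW, hg]
  refine congrArg (· + _) (h₄.trans (congrArg (_ + ·) (h₅.trans ?_)))
  simp only [smul_apply, smul_add]
  rfl

/-- The curvature of a bi-invariant metric in the left trivialization. -/
lemma dL_curvature (hbi : IsBiInvariantMetric I G) (hcov : IsLeviCivita cov) {g : G}
    (u v w : TangentSpace I g) :
    dL I g⁻¹ g (curvature cov u v w) =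
      -((1 / 4 : ℝ) • bracketCLM I G (bracketCLM I G (dL I g⁻¹ g u) (dL I g⁻¹ g v))
        (dL I g⁻¹ g w)) := by
  -- Coordinate fields commute, so vanishing torsion reads `∇_X Y - ∇_Y X = 0`; in the
  -- trivialization the two halves `½[u, v]` add up.
  have ht : mvfderiv I (leftHat (FiberBundle.extend E v)) g u -
      mvfderiv I (leftHat (FiberBundle.extend E u)) g v =
      -bracketCLM I G (dL I g⁻¹ g u) (dL I g⁻¹ g v) := by
    have h := cov_sub_cov hcov (FiberBundle.mdifferentiableAt_extend I E u)
      (FiberBundle.mdifferentiableAt_extend I E v)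
    rw [mlieBracket_extend, FiberBundle.extend_apply_self, FiberBundle.extend_apply_self] at h
    have h' : dL I g⁻¹ g (cov (FiberBundle.extend E v) g u) -
        dL I g⁻¹ g (cov (FiberBundle.extend E u) g v) = 0 :=
      (map_sub (dL I g⁻¹ g) _ _).symm.trans ((congrArg (dL I g⁻¹ g) h).trans (map_zero _))
    rw [dL_cov hbi hcov (FiberBundle.mdifferentiableAt_extend I E u),
      dL_cov hbi hcov (FiberBundle.mdifferentiableAt_extend I E v), leftHat_extend_self,
      leftHat_extend_self, bracketCLM_swap (dL I g⁻¹ g v)] at h'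
    rw [← sub_eq_zero, ← h']
    module
  have hc : dL I g⁻¹ g (curvature cov u v w) =
      dL I g⁻¹ g (cov (fun y ↦ cov (FiberBundle.extend E w) y (FiberBundle.extend E v y)) g u) -
      dL I g⁻¹ g (cov (fun y ↦ cov (FiberBundle.extend E w) y (FiberBundle.extend E u y)) g v) := by
    have h : curvature cov u v w =
        cov (fun y ↦ cov (FiberBundle.extend E w) y (FiberBundle.extend E v y)) g u -
        cov (fun y ↦ cov (FiberBundle.extend E w) y (FiberBundle.extend E u y)) g v := by
      rw [curvature, curvatureField, mlieBracket_extend, map_zero, sub_zero,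
        FiberBundle.extend_apply_self, FiberBundle.extend_apply_self]
    rw [h]
    exact map_sub (dL I g⁻¹ g) _ _
  rw [hc, dL_cov_cov_extend hbi hcov, dL_cov_cov_extend hbi hcov,
    mvfderiv_mvfderiv_extend_comm (contMDiffAt_leftHat_extend w) u v]
  -- The second derivatives and the terms with one derivative of `Ẑ` cancel. What is left is `-½[[u,
  -- v], w]` from `ht` and, by Jacobi, `+¼[[u, v], w]` from the iterated brackets.
  have hj := bracketCLM_jacobi (I := I) (G := G) (dL I g⁻¹ g u) (dL I g⁻¹ g v) (dL I g⁻¹ g w)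
  rw [sub_eq_iff_eq_add] at ht
  rw [ht]
  simp only [map_add, add_apply, map_smul, map_neg, neg_apply, hj]
  module

lemma curvature_one (hbi : IsBiInvariantMetric I G) (hcov : IsLeviCivita cov)
    (u v w : GroupLieAlgebra I G) :
    curvature cov u v w = -((1 / 4 : ℝ) • ⁅⁅u, v⁆, w⁆) := by
  have h := dL_curvature hbi hcov u v w
  have e (x : E) : dL I (1 : G)⁻¹ 1 x = x := by rw [inv_one, dL_one]
  have e₁ := (e (curvature cov u v w)).symm.trans h
  rw [e₁]
  exact congrArg (fun x : E ↦ -((1 / 4 : ℝ) • x))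
    (congrArg₂ (fun x y ↦ bracketCLM I G x y) (congrArg₂ (fun x y ↦ bracketCLM I G x y) (e u) (e v))
      (e w))

end Curvature

/-! ### Left-invariance of the Riemannian distance -/

section Distance

variable {E : Type*} [NormedAddCommGroup E] [NormedSpace ℝ E]
  {H : Type*} [TopologicalSpace H] {I : ModelWithCorners ℝ E H}
  {G : Type*} [TopologicalSpace G] [ChartedSpace H G] [Group G] [LieGroup I ∞ G]
  [RiemannianBundle (fun x : G ↦ TangentSpace I x)]

omit [LieGroup I ∞ G] in
lemma enorm_mfderiv_mul_left (hbi : IsBiInvariantMetric I G) (a x : G) (u : TangentSpace I x) :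
    ‖mfderiv I I (fun y ↦ a * y) x u‖ₑ = ‖u‖ₑ := by
  rw [enorm_eq_iff_norm_eq, @norm_eq_sqrt_real_inner _ _ _ (mfderiv I I (fun y ↦ a * y) x u),
    @norm_eq_sqrt_real_inner _ _ _ u, hbi.1 a x u u]

lemma pathELength_mul_left (hbi : IsBiInvariantMetric I G) (a : G) {γ : ℝ → G}
    (hγ : ContMDiffOn 𝓘(ℝ, ℝ) I 1 γ (Icc 0 1)) :
    pathELength I (fun t ↦ a * γ t) 0 1 = pathELength I γ 0 1 := by
  rw [pathELength_eq_lintegral_mfderivWithin_Icc, pathELength_eq_lintegral_mfderivWithin_Icc]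
  refine MeasureTheory.setLIntegral_congr_fun measurableSet_Icc fun t ht ↦ ?_
  have h := mfderiv_comp_mfderivWithin t (mdifferentiableAt_mulLeft (I := I) a (γ t))
    (hγ.mdifferentiableOn one_ne_zero t ht)
    ((uniqueDiffOn_Icc zero_lt_one).uniqueMDiffOn t ht)
  have e : mfderivWithin 𝓘(ℝ, ℝ) I (fun t ↦ a * γ t) (Icc 0 1) t 1 =
      mfderiv I I (fun y ↦ a * y) (γ t) (mfderivWithin 𝓘(ℝ, ℝ) I γ (Icc 0 1) t 1) :=
    DFunLike.congr_fun h 1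
  exact (congrArg (fun u : TangentSpace I (a * γ t) ↦ ‖u‖ₑ) e).trans
    (enorm_mfderiv_mul_left hbi a (γ t) _)

/-- Left translation carries paths to paths of the same length. The reverse inequality follows by
translating back with `a⁻¹`. -/
lemma riemannianEDist_mul_left_le (hbi : IsBiInvariantMetric I G) (a x y : G) :
    riemannianEDist I (a * x) (a * y) ≤ riemannianEDist I x y := by
  refine le_of_forall_gt fun r hr ↦ ?_
  obtain ⟨γ, h0, h1, hγ, hr⟩ := exists_lt_of_riemannianEDist_lt hr
  refine lt_of_le_of_lt ?_ hr
  rw [← pathELength_mul_left hbi a hγ]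
  exact riemannianEDist_le_pathELength
    (((contMDiff_mul_left (I := I) (n := ∞) (a := a)).of_le
      (WithTop.coe_le_coe.2 le_top)).comp_contMDiffOn hγ)
    (congrArg (a * ·) h0) (congrArg (a * ·) h1) zero_le_one

lemma riemDist_mul_left (hbi : IsBiInvariantMetric I G) (a x y : G) :
    riemDist I (a * x) (a * y) = riemDist I x y := by
  refine congrArg ENNReal.toReal (le_antisymm (riemannianEDist_mul_left_le hbi a x y) ?_)
  simpa using riemannianEDist_mul_left_le hbi a⁻¹ (a * x) (a * y)

end Distance

/-! ### Differentiating the left trivialization of a field along a curve -/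

section AlongCurves

variable {E : Type*} [NormedAddCommGroup E] [NormedSpace ℝ E]
  {H : Type*} [TopologicalSpace H] {I : ModelWithCorners ℝ E H}
  {G : Type*} [TopologicalSpace G] [ChartedSpace H G]

lemma trivializationAt_self_symm [IsManifold I 1 G] (g : G) (u : E) :
    (trivializationAt E (fun x : G ↦ TangentSpace I x) g).symm g u = u := by
  have h := (trivializationAt E (fun x : G ↦ TangentSpace I x) g).symm_apply_apply_mk
    (FiberBundle.mem_baseSet_trivializationAt' g) (u : TangentSpace I g)
  have e := trivializationAt_self_snd (I := I) g u
  exact (congrArg _ e).symm.trans h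

variable [Group G] [LieGroup I ∞ G]

/-- The differential of `τ ↦ g(τ)⁻¹ W(τ)` in terms of the trivialization around `g(t)`. -/
lemma hasDerivWithinAt_leftPull {s : Set ℝ} {q : ℝ → G} {W : ∀ t, TangentSpace I (q t)} {t : ℝ}
    (hW : MDifferentiableWithinAt 𝓘(ℝ, ℝ) I.tangent
      (fun τ ↦ (⟨q τ, W τ⟩ : TangentBundle I G)) s t) (ht : t ∈ s) :
    HasDerivWithinAt (fun τ ↦ dL I (q τ)⁻¹ (q τ) (W τ))
      (mvfderiv I (leftHat (FiberBundle.extend E (W t))) (q t) (velocity I s q t) +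
        dL I (q t)⁻¹ (q t) (derivWithin (fun τ ↦
          ((trivializationAt E (fun x : G ↦ TangentSpace I x) (q t))
            (⟨q τ, W τ⟩ : TangentBundle I G)).2) s t)) s t := by
  set e := trivializationAt E (fun x : G ↦ TangentSpace I x) (q t) with he
  set w : ℝ → E := fun τ ↦ (e (⟨q τ, W τ⟩ : TangentBundle I G)).2 with hw
  obtain ⟨hq, hw'⟩ : MDifferentiableWithinAt 𝓘(ℝ, ℝ) I q s t ∧
      MDifferentiableWithinAt 𝓘(ℝ, ℝ) 𝓘(ℝ, E) w s t := (mdifferentiableWithinAt_totalSpace I _).1 hW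
  have hwt : w t = W t := trivializationAt_self_snd (q t) (W t)
  have hb : q t ∈ e.baseSet := FiberBundle.mem_baseSet_trivializationAt' (q t)
  -- `P` is the left trivialization expressed in the bundle coordinates around `q t`. Its partial
  -- derivatives at `(q t, w t)` yield the two terms of the claim: fixing the coefficients gives the
  -- field `FiberBundle.extend`, and fixing the base point gives a linear map.
  let P : G × E → E := fun p ↦ dL I p.1⁻¹ p.1 (e.symm p.1 p.2)
  have hP : MDifferentiableAt (I.prod 𝓘(ℝ, E)) 𝓘(ℝ, E) P (q t, w t) := by
    have hs : ContMDiffAt (I.prod 𝓘(ℝ, E)) I.tangent ∞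
        (fun p : G × E ↦ (⟨p.1, e.symm p.1 p.2⟩ : TangentBundle I G)) (q t, w t) := by
      refine ((e.contMDiffOn_symm (IB := I) (n := ∞)).contMDiffAt
        (e.open_target.mem_nhds (e.mk_mem_target.2 hb))).congr_of_eventuallyEq ?_
      filter_upwards [(e.open_baseSet.preimage continuous_fst).mem_nhds
        (show q t ∈ e.baseSet from hb)] with p hp
      exact e.mk_symm hp p.2
    exact ((contMDiff_leftPull (I := I) (G := G)).contMDiffAt.comp (q t, w t) hs).mdifferentiableAt
      (by simp)
  have hf := hq.hasMFDerivWithinAt.prodMk hw'.hasMFDerivWithinAt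
  let D : ℝ →L[ℝ] E := (mfderiv (I.prod 𝓘(ℝ, E)) 𝓘(ℝ, E) P (q t, w t)).comp
    ((mfderivWithin 𝓘(ℝ, ℝ) I q s t).prod (mfderivWithin 𝓘(ℝ, ℝ) 𝓘(ℝ, E) w s t))
  have hc : HasFDerivWithinAt (fun τ ↦ P (q τ, w τ)) D s t :=
    (HasMFDerivAt.comp_hasMFDerivWithinAt (g := P) t hP.hasMFDerivAt hf).hasFDerivWithinAt
  have hcongr : ∀ᶠ τ in nhdsWithin t s, dL I (q τ)⁻¹ (q τ) (W τ) = P (q τ, w τ) := by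
    filter_upwards [hq.continuousWithinAt (e.open_baseSet.mem_nhds hb)] with τ hτ
    exact congrArg (dL I (q τ)⁻¹ (q τ)) (e.symm_apply_apply_mk hτ (W τ)).symm
  refine (hc.hasDerivWithinAt.congr_of_eventuallyEq_of_mem hcongr ht).congr_deriv ?_
  refine (mfderiv_prod_eq_add_apply hP).trans ?_
  refine congrArg₂ (· + ·) ?_ ?_
  · rfl
  · have h2 : (fun z : E ↦ P (q t, z)) = dL I (q t)⁻¹ (q t) := by
      funext z
      exact congrArg (dL I (q t)⁻¹ (q t)) (trivializationAt_self_symm (q t) z)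
    have h3 : mfderiv 𝓘(ℝ, E) 𝓘(ℝ, E) (fun z : E ↦ P (q t, z)) (w t) = dL I (q t)⁻¹ (q t) := by
      rw [h2]
      exact (dL I (q t)⁻¹ (q t)).mfderiv_eq
    have h4 : mfderivWithin 𝓘(ℝ, ℝ) 𝓘(ℝ, E) w s t (1 : ℝ) = derivWithin w s t := by
      rw [mfderivWithin_eq_fderivWithin]
      rfl
    exact (DFunLike.congr_fun h3 _).trans (congrArg (dL I (q t)⁻¹ (q t)) h4)

end AlongCurves

/-! ### Iterated covariant derivatives along curves -/

section LeftTrivializedCurves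

variable {E : Type*} [NormedAddCommGroup E] [NormedSpace ℝ E]
  {H : Type*} [TopologicalSpace H] {I : ModelWithCorners ℝ E H}
  {G : Type*} [TopologicalSpace G] [ChartedSpace H G]

lemma contMDiffOn_velocity [IsManifold I ∞ G] {s : Set ℝ} (hs : UniqueDiffOn ℝ s) {q : ℝ → G}
    (hq : ContMDiffOn 𝓘(ℝ, ℝ) I ∞ q s) :
    ContMDiffOn 𝓘(ℝ, ℝ) I.tangent ∞
      (fun t ↦ (⟨q t, velocity I s q t⟩ : TangentBundle I G)) s := by
  have h := hq.contMDiffOn_tangentMapWithin (m := ∞) (by simp) hs.uniqueMDiffOn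
  have h₁ : ContMDiff 𝓘(ℝ, ℝ) 𝓘(ℝ, ℝ).tangent ∞
      (fun t : ℝ ↦ (⟨t, (1 : ℝ)⟩ : TangentBundle 𝓘(ℝ, ℝ) ℝ)) := by
    intro t
    refine contMDiffAt_totalSpace.2 ⟨contMDiffAt_id, ?_⟩
    refine contMDiffAt_const (c := (1 : ℝ)) |>.congr_of_eventuallyEq (.of_forall fun τ ↦ ?_)
    simp
  exact h.comp h₁.contMDiffOn (fun t ht ↦ ht)

variable [Group G] [LieGroup I ∞ G]

lemma contDiffOn_bodyVelocity {s : Set ℝ} (hs : UniqueDiffOn ℝ s) {q : ℝ → G}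
    (hq : ContMDiffOn 𝓘(ℝ, ℝ) I ∞ q s) :
    ContDiffOn ℝ ∞ (fun t ↦ dL I (q t)⁻¹ (q t) (velocity I s q t)) s :=
  contMDiffOn_iff_contDiffOn.1
    ((contMDiff_leftPull (I := I) (G := G)).comp_contMDiffOn (contMDiffOn_velocity hs hq))

/-- This makes it possible to iterate `covDerivAlong`: the regularity of each new field along `q` is
read off from its explicit left trivialization. -/
lemma mdifferentiableWithinAt_of_leftPull {s : Set ℝ} {q : ℝ → G}
    {W : ∀ t, TangentSpace I (q t)} {w : ℝ → E} {t : ℝ} (ht : t ∈ s)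
    (hq : ContMDiffOn 𝓘(ℝ, ℝ) I ∞ q s) (hw : ContDiffOn ℝ ∞ w s)
    (h : ∀ t ∈ s, dL I (q t)⁻¹ (q t) (W t) = w t) :
    MDifferentiableWithinAt 𝓘(ℝ, ℝ) I.tangent
      (fun τ ↦ (⟨q τ, W τ⟩ : TangentBundle I G)) s t := by
  have h₁ : ContMDiffOn 𝓘(ℝ, ℝ) I.tangent ∞
      (fun τ ↦ (⟨q τ, dL I (q τ) 1 (w τ)⟩ : TangentBundle I G)) s :=
    (contMDiff_leftPush (I := I) (G := G)).comp_contMDiffOn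
      (hq.prodMk (contMDiffOn_iff_contDiffOn.2 hw))
  refine (h₁.mdifferentiableOn (by simp) t ht).congr_of_mem (fun τ hτ ↦ ?_) ht
  refine totalSpace_mk_eq rfl ?_
  rw [← h τ hτ]
  exact (dL_dL_inv (I := I) (E := E) (q τ) (W τ)).symm

variable [CompleteSpace E] [FiniteDimensional ℝ E]

lemma derivWithin_add_half_bracket {s : Set ℝ} (hs : UniqueDiffOn ℝ s) {ξ : ℝ → E}
    (hξ : ContDiffOn ℝ ∞ ξ s) {t : ℝ} (ht : t ∈ s) :
    derivWithin (fun τ ↦ derivWithin (derivWithin ξ s) s τ +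
      (1 / 2 : ℝ) • bracketCLM I G (ξ τ) (derivWithin ξ s τ)) s t =
      derivWithin (derivWithin (derivWithin ξ s) s) s t +
        (1 / 2 : ℝ) • bracketCLM I G (ξ t) (derivWithin (derivWithin ξ s) s t) := by
  have h1 : ContDiffOn ℝ ∞ (derivWithin ξ s) s := hξ.derivWithin hs (by simp)
  have h2 : ContDiffOn ℝ ∞ (derivWithin (derivWithin ξ s) s) s := h1.derivWithin hs (by simp)
  have d0 := (hξ.differentiableOn (by simp) t ht).hasDerivWithinAt
  have d1 := (h1.differentiableOn (by simp) t ht).hasDerivWithinAt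
  have d2 := (h2.differentiableOn (by simp) t ht).hasDerivWithinAt
  have dB := (bracketCLM I G).hasDerivWithinAt_of_bilinear d0 d1
  -- The other product-rule term is `[ξ̇, ξ̇] = 0`.
  rw [bracketCLM_self, add_zero] at dB
  exact (d2.add (dB.const_smul (1 / 2 : ℝ))).derivWithin (hs t ht)

variable
  [RiemannianBundle (fun x : G ↦ TangentSpace I x)]
  [IsContMDiffRiemannianBundle I ∞ E (fun x : G ↦ TangentSpace I x)]
  {cov : CovariantDerivative I E (fun x : G ↦ TangentSpace I x)} [I.Boundaryless]

/-- The covariant derivative along a curve in the left trivialization. -/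
lemma dL_covDerivAlong (hbi : IsBiInvariantMetric I G) (hcov : IsLeviCivita cov) {s : Set ℝ}
    (hs : UniqueDiffOn ℝ s) {q : ℝ → G} {W : ∀ t, TangentSpace I (q t)} {w : ℝ → E}
    (hq : ContMDiffOn 𝓘(ℝ, ℝ) I ∞ q s) (hw : ContDiffOn ℝ ∞ w s)
    (h : ∀ t ∈ s, dL I (q t)⁻¹ (q t) (W t) = w t) {t : ℝ} (ht : t ∈ s) :
    dL I (q t)⁻¹ (q t) (covDerivAlong cov s q W t) =
      derivWithin w s t + (1 / 2 : ℝ) • bracketCLM I G (dL I (q t)⁻¹ (q t) (velocity I s q t)) (w t) := by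
  have h₁ := hasDerivWithinAt_leftPull (mdifferentiableWithinAt_of_leftPull ht hq hw h) ht
  have h₂ := (h₁.congr (fun τ hτ ↦ (h τ hτ).symm) (h t ht).symm).derivWithin (hs t ht)
  have h₃ := dL_cov hbi hcov (FiberBundle.mdifferentiableAt_extend I E (W t)) (velocity I s q t)
  rw [leftHat_extend_self, h t ht] at h₃
  rw [h₂]
  refine (map_add (dL I (q t)⁻¹ (q t)) _ _).trans ?_
  refine (congrArg₂ (· + ·) (congrArg (dL I (q t)⁻¹ (q t)) (trivializationAt_self_symm _ _))
    h₃).trans ?_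
  exact (by intro a b c; abel : ∀ a b c : E, a + (b + c) = b + a + c) _ _ _

/-- The left-hand side of the necessary conditions in the left trivialization. -/
lemma dL_necessary (hbi : IsBiInvariantMetric I G) (hcov : IsLeviCivita cov) {s : Set ℝ}
    (hs : UniqueDiffOn ℝ s) {q : ℝ → G} (hq : ContMDiffOn 𝓘(ℝ, ℝ) I ∞ q s) {ξ : ℝ → E}
    (hξ : ∀ t, dL I (q t)⁻¹ (q t) (velocity I s q t) = ξ t) {t : ℝ} (ht : t ∈ s) :
    dL I (q t)⁻¹ (q t) (covDerivAlong cov s q (covDerivAlong cov s q (covDerivAlong cov s q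
        (velocity I s q))) t
      + curvature cov (covDerivAlong cov s q (velocity I s q) t)
          (velocity I s q t) (velocity I s q t)) =
      derivWithin (derivWithin (derivWithin ξ s) s) s t +
        bracketCLM I G (ξ t) (derivWithin (derivWithin ξ s) s t) := by
  have h0 : ContDiffOn ℝ ∞ ξ s := (contDiffOn_bodyVelocity hs hq).congr fun t _ ↦ (hξ t).symm
  have h1 : ContDiffOn ℝ ∞ (derivWithin ξ s) s := h0.derivWithin hs (by simp)
  have h2 : ContDiffOn ℝ ∞ (derivWithin (derivWithin ξ s) s) s := h1.derivWithin hs (by simp)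
  have hB {f f' : ℝ → E} (hf : ContDiffOn ℝ ∞ f s) (hf' : ContDiffOn ℝ ∞ f' s) :
      ContDiffOn ℝ ∞ (fun t ↦ bracketCLM I G (f t) (f' t)) s :=
    ((bracketCLM I G).contDiff.comp_contDiffOn hf).clm_apply hf'
  have e0 : ∀ τ ∈ s, dL I (q τ)⁻¹ (q τ) (velocity I s q τ) = ξ τ := fun τ _ ↦ hξ τ
  have e1 : ∀ τ ∈ s, dL I (q τ)⁻¹ (q τ) (covDerivAlong cov s q (velocity I s q) τ) =
      derivWithin ξ s τ := fun τ hτ ↦ by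
    refine (dL_covDerivAlong hbi hcov hs hq h0 e0 hτ).trans ?_
    rw [hξ, bracketCLM_self]
    simp
  have e2 : ∀ τ ∈ s, dL I (q τ)⁻¹ (q τ) (covDerivAlong cov s q (covDerivAlong cov s q
      (velocity I s q)) τ) =
      derivWithin (derivWithin ξ s) s τ + (1 / 2 : ℝ) • bracketCLM I G (ξ τ) (derivWithin ξ s τ) :=
    fun τ hτ ↦ by
    refine (dL_covDerivAlong hbi hcov hs hq h1 e1 hτ).trans ?_
    rw [hξ]
  have h3 : ContDiffOn ℝ ∞ (fun τ ↦ derivWithin (derivWithin ξ s) s τ +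
      (1 / 2 : ℝ) • bracketCLM I G (ξ τ) (derivWithin ξ s τ)) s :=
    h2.add (contDiffOn_const.smul (hB h0 h1))
  have e3 := dL_covDerivAlong hbi hcov hs hq h3 e2 ht
  have hR := dL_curvature hbi hcov (covDerivAlong cov s q (velocity I s q) t)
    (velocity I s q t) (velocity I s q t)
  rw [e1 t ht, e0 t ht] at hR
  refine (map_add (dL I (q t)⁻¹ (q t)) _ _).trans ((congrArg₂ (· + ·) e3 hR).trans ?_)
  -- Two skew-symmetries turn `[[ξ̇, ξ], ξ]` into `[ξ, [ξ, ξ̇]]`, so the curvature cancels the term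
  -- `½ · ½ [ξ, [ξ, ξ̇]]` of the third covariant derivative.
  rw [hξ, derivWithin_add_half_bracket hs h0 ht, bracketCLM_swap (derivWithin ξ s t), map_neg, neg_apply,
    bracketCLM_swap (bracketCLM I G (ξ t) (derivWithin ξ s t)), map_add, map_smul]
  module

end LeftTrivializedCurves

/-! ### Gradients of left-invariant potentials -/

section Gradient

variable {E : Type*} [NormedAddCommGroup E] [NormedSpace ℝ E] [FiniteDimensional ℝ E]
  {H : Type*} [TopologicalSpace H] {I : ModelWithCorners ℝ E H}
  {G : Type*} [TopologicalSpace G] [ChartedSpace H G]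
  [RiemannianBundle (fun x : G ↦ TangentSpace I x)]

lemma metric_grad₁ [IsManifold I 1 G] (V : G → G → ℝ) (g x : G) (u : E) :
    metric I g (grad₁ I V g x) u = mvfderiv I (fun q ↦ V q x) g u :=
  haveI : FiniteDimensional ℝ (TangentSpace I g) := inferInstanceAs (FiniteDimensional ℝ E)
  haveI : CompleteSpace (TangentSpace I g) := FiniteDimensional.complete ℝ _
  InnerProductSpace.toDual_symm_apply (𝕜 := ℝ) (E := TangentSpace I g)

variable [Group G] [LieGroup I ∞ G]

omit [FiniteDimensional ℝ E] [RiemannianBundle (fun x : G ↦ TangentSpace I x)] in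
lemma mvfderiv_leftInvariant {V : G → G → ℝ} (hV : IsLeftInvariant V) {g x : G}
    (hd : MDifferentiableAt I 𝓘(ℝ, ℝ) (fun q ↦ V q (g⁻¹ * x)) 1) (u : E) :
    mvfderiv I (fun q ↦ V q x) g u = mvfderiv I (fun q ↦ V q (g⁻¹ * x)) 1 (dL I g⁻¹ g u) := by
  have e : (fun q ↦ V q x) = (fun q ↦ V q (g⁻¹ * x)) ∘ fun q ↦ g⁻¹ * q :=
    funext fun q ↦ (hV g⁻¹ q x).symm
  rw [e]
  exact (DFunLike.congr_fun (mfderiv_comp_of_eq (I := I) (I' := I) (I'' := 𝓘(ℝ, ℝ)) (x := g)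
    (f := fun y ↦ g⁻¹ * y) hd (mdifferentiableAt_mulLeft g⁻¹ g) (inv_mul_cancel g)) u).trans
    (mvfderiv_congr_point (F := ℝ) (inv_mul_cancel g) _)

/-- The gradient of a left-invariant function in the left trivialization. -/
lemma dL_grad₁ (hbi : IsBiInvariantMetric I G) {V : G → G → ℝ} (hV : IsLeftInvariant V) {g x : G}
    (hd : MDifferentiableAt I 𝓘(ℝ, ℝ) (fun q ↦ V q (g⁻¹ * x)) 1) :
    dL I g⁻¹ g (grad₁ I V g x) = grad₁ I V (1 : G) (g⁻¹ * x) := by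
  refine eq_of_metric_eq (I := I) (g := (1 : G)) fun w ↦ ?_
  -- The test vector `w` is written as `g⁻¹(g w)`, so that the isometry `g⁻¹` moves the pairing to
  -- `g`, where it is the differential of `V`.
  have h := metric_dL hbi g⁻¹ g (grad₁ I V g x) (dL I g 1 w)
  rw [inv_mul_cancel, dL_inv_dL] at h
  rw [h, metric_grad₁, metric_grad₁, mvfderiv_leftInvariant hV hd, dL_inv_dL]

end Gradient

/-! ### Velocity of the relative configuration `g_j⁻¹g_k` -/

section RelativeMotion

variable {E : Type*} [NormedAddCommGroup E] [NormedSpace ℝ E]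
  {H : Type*} [TopologicalSpace H] {I : ModelWithCorners ℝ E H}
  {G : Type*} [TopologicalSpace G] [ChartedSpace H G] [Group G] [LieGroup I ∞ G]

lemma velocity_mul {s : Set ℝ} {u v : ℝ → G} {t : ℝ} (hs : UniqueDiffWithinAt ℝ s t)
    (hu : MDifferentiableWithinAt 𝓘(ℝ, ℝ) I u s t)
    (hv : MDifferentiableWithinAt 𝓘(ℝ, ℝ) I v s t) :
    velocity I s (fun τ ↦ u τ * v τ) t =
      (dR I (v t) (u t) (velocity I s u t) + dL I (u t) (v t) (velocity I s v t) : E) := by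
  have hm : MDifferentiableAt (I.prod I) I (fun p : G × G ↦ p.1 * p.2) (u t, v t) :=
    (contMDiff_mul I ∞).mdifferentiable (by simp) _
  have h₁ := (hm.hasMFDerivAt.comp_hasMFDerivWithinAt t
    (hu.hasMFDerivWithinAt.prodMk hv.hasMFDerivWithinAt)).mfderivWithin hs.uniqueMDiffWithinAt
  exact (DFunLike.congr_fun h₁ (1 : ℝ)).trans (mfderiv_prod_eq_add_apply hm)

/-- Differentiate `u⁻¹u = 1` and solve for the velocity of `u⁻¹` by right translation with `u⁻¹`. -/
lemma velocity_inv {s : Set ℝ} {u : ℝ → G} {t : ℝ} (hs : UniqueDiffWithinAt ℝ s t)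
    (hu : MDifferentiableWithinAt 𝓘(ℝ, ℝ) I u s t) :
    velocity I s (fun τ ↦ (u τ)⁻¹) t =
      (-dR I (u t)⁻¹ 1 (dL I (u t)⁻¹ (u t) (velocity I s u t)) : E) := by
  have hi : MDifferentiableWithinAt 𝓘(ℝ, ℝ) I (fun τ ↦ (u τ)⁻¹) s t :=
    ((contMDiff_inv I ∞).mdifferentiable (by simp) (u t)).comp_mdifferentiableWithinAt t hu
  have h := velocity_mul hs hi hu
  have h₁ : velocity I s (fun τ ↦ (u τ)⁻¹ * u τ) t = (0 : E) := by
    have e : (fun τ ↦ (u τ)⁻¹ * u τ) = fun _ ↦ (1 : G) := funext fun τ ↦ inv_mul_cancel _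
    have h₂ : (mfderivWithin 𝓘(ℝ, ℝ) I (fun _ : ℝ ↦ (1 : G)) s t : ℝ →L[ℝ] E) = 0 :=
      mfderivWithin_const
    have h₃ : ∀ f : ℝ → G, f = (fun _ ↦ (1 : G)) → velocity I s f t = (0 : E) := by
      rintro f rfl
      exact DFunLike.congr_fun h₂ (1 : ℝ)
    exact h₃ _ e
  have h₄ := eq_neg_of_add_eq_zero_left (h.symm.trans h₁)
  have h₅ := congrArg (dR I (u t)⁻¹ 1) h₄
  have h₆ (x : E) : dR I (u t)⁻¹ 1 (dR I (u t) (u t)⁻¹ x) = x := by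
    have := dR_dR (I := I) (u t)⁻¹ (u t) (u t)⁻¹ x
    rwa [inv_mul_cancel, mul_inv_cancel, dR_one] at this
  exact (h₆ _).symm.trans (h₅.trans (map_neg _ _))

lemma velocity_inv_mul {s : Set ℝ} {u v : ℝ → G} {t : ℝ} (hs : UniqueDiffWithinAt ℝ s t)
    (hu : MDifferentiableWithinAt 𝓘(ℝ, ℝ) I u s t)
    (hv : MDifferentiableWithinAt 𝓘(ℝ, ℝ) I v s t) :
    velocity I s (fun τ ↦ (u τ)⁻¹ * v τ) t =
      - rightPush ((u t)⁻¹ * v t) (bodyVelocity I s u t) +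
        leftPush ((u t)⁻¹ * v t) (bodyVelocity I s v t) := by
  have hi : MDifferentiableWithinAt 𝓘(ℝ, ℝ) I (fun τ ↦ (u τ)⁻¹) s t :=
    ((contMDiff_inv I ∞).mdifferentiable (by simp) (u t)).comp_mdifferentiableWithinAt t hu
  have h := velocity_mul hs hi hv
  have h₁ := dR_dR (I := I) (v t) (u t)⁻¹ 1 (dL I (u t)⁻¹ (u t) (velocity I s u t))
  have h₂ (x : E) : dL I (u t)⁻¹ (v t) x = dL I ((u t)⁻¹ * v t) 1 (dL I (v t)⁻¹ (v t) x) := by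
    have := dL_dL (I := I) (u t)⁻¹ (v t) 1 (dL I (v t)⁻¹ (v t) x)
    rwa [mul_one, dL_dL_inv] at this
  rw [one_mul] at h₁
  refine h.trans (congrArg₂ (fun x y : E ↦ x + y) ?_ (h₂ _))
  exact (congrArg (dR I (v t) (u t)⁻¹) (velocity_inv hs hu)).trans
    ((map_neg (dR I (v t) (u t)⁻¹) _).trans (congrArg (fun x : E ↦ -x) h₁))

end RelativeMotion

/-! ### Equivalence of the three systems -/

section Equivalence

variable {E : Type*} [NormedAddCommGroup E] [NormedSpace ℝ E] [FiniteDimensional ℝ E]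
  [CompleteSpace E]
  {H : Type*} [TopologicalSpace H] {I : ModelWithCorners ℝ E H} [I.Boundaryless]
  {G : Type*} [TopologicalSpace G] [ChartedSpace H G] [Group G] [LieGroup I ∞ G]
  [RiemannianBundle (fun x : G ↦ TangentSpace I x)]
  [IsContMDiffRiemannianBundle I ∞ E (fun x : G ↦ TangentSpace I x)]
  {cov : CovariantDerivative I E (fun x : G ↦ TangentSpace I x)}
  {n : ℕ} {𝒢 : SimpleGraph (Fin n)} [DecidableRel 𝒢.Adj] {V : Fin n → Fin n → G → G → ℝ}
  {s : Set ℝ} {g : Fin n → ℝ → G}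

omit [FiniteDimensional ℝ E] [CompleteSpace E] [I.Boundaryless]
  [RiemannianBundle (fun x : G ↦ TangentSpace I x)]
  [IsContMDiffRiemannianBundle I ∞ E (fun x : G ↦ TangentSpace I x)] [DecidableRel 𝒢.Adj] in
lemma relativeEquation (hs : UniqueDiffOn ℝ s) (hg : ∀ j, ContMDiffOn 𝓘(ℝ, ℝ) I ∞ (g j) s) :
    RelativeEquation 𝒢 s (fun j ↦ bodyVelocity I s (g j)) (fun j k t ↦ (g j t)⁻¹ * g k t) :=
  fun j k _ t ht ↦ velocity_inv_mul (hs t ht) ((hg j).mdifferentiableOn (by simp) t ht)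
    ((hg k).mdifferentiableOn (by simp) t ht)

omit [CompleteSpace E] [I.Boundaryless]
  [IsContMDiffRiemannianBundle I ∞ E (fun x : G ↦ TangentSpace I x)] in
lemma dL_sum_grad₁ (hbi : IsBiInvariantMetric I G)
    (hV : ∀ j k, 𝒢.Adj j k →
      ContMDiff (I.prod I) 𝓘(ℝ, ℝ) ∞ (fun p : G × G ↦ V j k p.1 p.2) ∧ IsLeftInvariant (V j k))
    (j : Fin n) (x : Fin n → G) :
    dL I (x j)⁻¹ (x j) (-∑ r ∈ 𝒢.neighborFinset j, grad₁ I (V j r) (x j) (x r)) =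
      (-∑ r ∈ 𝒢.neighborFinset j, grad₁ I (V j r) (1 : G) ((x j)⁻¹ * x r) : E) := by
  refine (map_neg (dL I (x j)⁻¹ (x j)) _).trans (congrArg (fun y : E ↦ -y) ?_)
  refine (map_sum (dL I (x j)⁻¹ (x j)) _ _).trans (Finset.sum_congr rfl fun r hr ↦ ?_)
  obtain ⟨hs, hl⟩ := hV j r ((𝒢.mem_neighborFinset j r).1 hr)
  refine dL_grad₁ hbi hl ?_
  exact (hs.comp (contMDiff_id.prodMk contMDiff_const)).mdifferentiable (by simp) 1

/-- The trivialization `u ↦ g⁻¹u` maps both sides of one equation to those of the other, and it is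
injective. -/
lemma necessaryConditions_iff (hbi : IsBiInvariantMetric I G) (hcov : IsLeviCivita cov)
    (hV : ∀ j k, 𝒢.Adj j k →
      ContMDiff (I.prod I) 𝓘(ℝ, ℝ) ∞ (fun p : G × G ↦ V j k p.1 p.2) ∧ IsLeftInvariant (V j k))
    (hs : UniqueDiffOn ℝ s) (hg : ∀ j, ContMDiffOn 𝓘(ℝ, ℝ) I ∞ (g j) s) :
    NecessaryConditions cov 𝒢 V s g ↔
      BiInvariantConditions 𝒢 V s (fun j ↦ bodyVelocity I s (g j))
        (fun j k t ↦ (g j t)⁻¹ * g k t) := by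
  have h (j : Fin n) (t : ℝ) (ht : t ∈ s) := dL_necessary hbi hcov hs (hg j)
    (ξ := fun t ↦ dL I (g j t)⁻¹ (g j t) (velocity I s (g j) t)) (fun _ ↦ rfl) ht
  have h' (j : Fin n) (t : ℝ) := dL_sum_grad₁ hbi hV j (fun k ↦ g k t)
  constructor
  · refine fun hn ↦ ⟨relativeEquation hs hg, fun j t ht ↦ ?_⟩
    exact (h j t ht).symm.trans ((congrArg (dL I (g j t)⁻¹ (g j t)) (hn j t ht)).trans (h' j t))
  · exact fun hn j t ht ↦ dL_injective (I := I) (E := E) (g j t)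
      ((h j t ht).trans ((hn.2 j t ht).trans (h' j t).symm))

lemma reducedConditions_iff (hbi : IsBiInvariantMetric I G) (hcov : IsLeviCivita cov)
    (hs : UniqueDiffOn ℝ s) (hg : ∀ j, ContMDiffOn 𝓘(ℝ, ℝ) I ∞ (g j) s) :
    ReducedConditions cov 𝒢 V s (fun j ↦ bodyVelocity I s (g j))
        (fun j k t ↦ (g j t)⁻¹ * g k t) ↔
      BiInvariantConditions 𝒢 V s (fun j ↦ bodyVelocity I s (g j))
        (fun j k t ↦ (g j t)⁻¹ * g k t) := by
  let ξ (j : Fin n) (t : ℝ) : E := dL I (g j t)⁻¹ (g j t) (velocity I s (g j) t)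
  have hξ (j) : ContDiffOn ℝ ∞ (ξ j) s := contDiffOn_bodyVelocity hs (hg j)
  let B := bracketCLM I G
  have hc (u v : E) : gConnection cov u v = (1 / 2 : ℝ) • B u v := gConnection_eq hbi hcov u v
  have hR (u v w : E) : (curvature cov (x := (1 : G)) u v w : E) = -((1 / 4 : ℝ) • B (B u v) w) :=
    curvature_one hbi hcov u v w
  -- Same cancellation as in `dL_necessary`. The auxiliary curves are prescribed only on `s`, which
  -- suffices because all derivatives are taken within `s`.
  have key (ξ₁ ξ₂ : Fin n → ℝ → E) (h₁ : ∀ j, ∀ t ∈ s, ξ₁ j t = derivWithin (ξ j) s t)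
      (h₂ : ∀ j, ∀ t ∈ s, ξ₂ j t = derivWithin (derivWithin (ξ j) s) s t +
        (1 / 2 : ℝ) • B (ξ j t) (derivWithin (ξ j) s t)) (j : Fin n) (t : ℝ) (ht : t ∈ s) :
      derivWithin (ξ₂ j) s t + (1 / 2 : ℝ) • B (ξ j t) (ξ₂ j t) +
        -((1 / 4 : ℝ) • B (B (ξ₁ j t) (ξ j t)) (ξ j t)) =
      derivWithin (derivWithin (derivWithin (ξ j) s) s) s t +
        B (ξ j t) (derivWithin (derivWithin (ξ j) s) s t) := by
    rw [derivWithin_congr (h₂ j) (h₂ j t ht), h₂ j t ht, h₁ j t ht,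
      derivWithin_add_half_bracket hs (hξ j) ht, bracketCLM_swap (derivWithin (ξ j) s t), map_neg,
      neg_apply, bracketCLM_swap (B (ξ j t) (derivWithin (ξ j) s t)), map_add, map_smul]
    module
  have lhs (ξ₁ ξ₂ : Fin n → ℝ → GroupLieAlgebra I G) (j : Fin n) (t : ℝ) :
      dot s (ξ₂ j) t + gConnection cov (ξ j t) (ξ₂ j t) + curvature cov (ξ₁ j t) (ξ j t) (ξ j t) =
      (derivWithin (F := E) (ξ₂ j) s t + (1 / 2 : ℝ) • B (ξ j t) (ξ₂ j t) +
        -((1 / 4 : ℝ) • B (B (ξ₁ j t) (ξ j t)) (ξ j t)) : E) :=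
    congrArg₂ (fun x y : E ↦ derivWithin (F := E) (ξ₂ j) s t + x + y) (hc _ _) (hR _ _ _)
  refine and_congr_right fun _ ↦ ⟨?_, fun h ↦ ?_⟩
  · rintro ⟨ξ₁', ξ₂', e₁, e₂, e₃⟩ j t ht
    let ξ₁ : Fin n → ℝ → E := ξ₁'
    let ξ₂ : Fin n → ℝ → E := ξ₂'
    -- The first two reduced equations determine the auxiliary curves on `s`: `[ξ, ξ] = 0` gives the
    -- first one, and substituting it gives the second.
    have f₁ (j) (t) (ht : t ∈ s) : ξ₁ j t = derivWithin (ξ j) s t := by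
      have h : derivWithin (ξ j) s t = ξ₁ j t - (1 / 2 : ℝ) • B (ξ j t) (ξ j t) :=
        (e₁ j t ht).trans (congrArg (fun x : E ↦ ξ₁ j t - x) (hc _ _))
      rw [h, bracketCLM_self, smul_zero, sub_zero]
    have f₂ (j) (t) (ht : t ∈ s) : ξ₂ j t = derivWithin (derivWithin (ξ j) s) s t +
        (1 / 2 : ℝ) • B (ξ j t) (derivWithin (ξ j) s t) := by
      have h : derivWithin (ξ₁ j) s t = ξ₂ j t - (1 / 2 : ℝ) • B (ξ j t) (ξ₁ j t) :=
        (e₂ j t ht).trans (congrArg (fun x : E ↦ ξ₂ j t - x) (hc _ _))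
      rw [derivWithin_congr (f₁ j) (f₁ j t ht), f₁ j t ht, eq_sub_iff_add_eq] at h
      exact h.symm
    exact (key ξ₁ ξ₂ f₁ f₂ j t ht).symm.trans ((lhs ξ₁ ξ₂ j t).symm.trans (e₃ j t ht))
  · let ξ₁ (j : Fin n) (t : ℝ) : E := derivWithin (ξ j) s t
    let ξ₂ (j : Fin n) (t : ℝ) : E := derivWithin (derivWithin (ξ j) s) s t +
      (1 / 2 : ℝ) • B (ξ j t) (derivWithin (ξ j) s t)
    refine ⟨ξ₁, ξ₂, fun j t _ ↦ ?_, fun j t _ ↦ ?_, fun j t ht ↦ ?_⟩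
    · have h : derivWithin (ξ j) s t = ξ₁ j t - (1 / 2 : ℝ) • B (ξ j t) (ξ j t) := by
        rw [bracketCLM_self, smul_zero, sub_zero]
      exact h.trans (congrArg (fun x : E ↦ ξ₁ j t - x) (hc _ _).symm)
    · have h : derivWithin (ξ₁ j) s t = ξ₂ j t - (1 / 2 : ℝ) • B (ξ j t) (ξ₁ j t) :=
        (add_sub_cancel_right _ _).symm
      exact h.trans (congrArg (fun x : E ↦ ξ₂ j t - x) (hc _ _).symm)
    · exact (lhs ξ₁ ξ₂ j t).trans ((key ξ₁ ξ₂ (fun _ _ _ ↦ rfl) (fun _ _ _ ↦ rfl) j t ht).trans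
        (h j t ht))

end Equivalence

end CollisionAvoidance
end

open CollisionAvoidance in
theorem corollary1
    {E : Type*} [NormedAddCommGroup E] [NormedSpace ℝ E] [FiniteDimensional ℝ E] [CompleteSpace E]
    {H : Type*} [TopologicalSpace H] (I : ModelWithCorners ℝ E H) [I.Boundaryless]
    (G : Type*) [TopologicalSpace G] [T2Space G] [ConnectedSpace G] [ChartedSpace H G]
    [Group G] [LieGroup I ∞ G]
    [RiemannianBundle (fun x : G ↦ TangentSpace I x)]
    [IsContMDiffRiemannianBundle I ∞ E (fun x : G ↦ TangentSpace I x)]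
    (hbi : IsBiInvariantMetric I G)
    (cov : CovariantDerivative I E (fun x : G ↦ TangentSpace I x)) (hcov : IsLeviCivita cov) :
    (∀ ξ η : GroupLieAlgebra I G, gConnection cov ξ η = (1 / 2 : ℝ) • ⁅ξ, η⁆) ∧
    (∀ ξ η σ : GroupLieAlgebra I G, curvature cov ξ η σ = -((1 / 4 : ℝ) • ⁅⁅ξ, η⁆, σ⁆)) ∧
    (∀ f : ℝ → ℝ, IsLeftInvariant (fun p q : G ↦ f (riemDist I p q ^ 2))) ∧
    (∀ (n : ℕ) (𝒢 : SimpleGraph (Fin n)) [DecidableRel 𝒢.Adj] (V : Fin n → Fin n → G → G → ℝ),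
      (∀ j k, 𝒢.Adj j k →
        ContMDiff (I.prod I) 𝓘(ℝ, ℝ) ∞ (fun p : G × G ↦ V j k p.1 p.2) ∧
        IsLeftInvariant (V j k)) →
      ∀ (a b : ℝ), a < b → ∀ g : Fin n → ℝ → G,
        (∀ j, ContMDiffOn 𝓘(ℝ, ℝ) I ∞ (g j) (Icc a b)) →
        (NecessaryConditions cov 𝒢 V (Icc a b) g ↔
          BiInvariantConditions 𝒢 V (Icc a b) (fun j ↦ bodyVelocity I (Icc a b) (g j))
            (fun j k t ↦ (g j t)⁻¹ * g k t)) ∧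
        (ReducedConditions cov 𝒢 V (Icc a b) (fun j ↦ bodyVelocity I (Icc a b) (g j))
            (fun j k t ↦ (g j t)⁻¹ * g k t) ↔
          BiInvariantConditions 𝒢 V (Icc a b) (fun j ↦ bodyVelocity I (Icc a b) (g j))
            (fun j k t ↦ (g j t)⁻¹ * g k t))) :=
  ⟨gConnection_eq hbi hcov, curvature_one hbi hcov,
    fun f h p q ↦ congrArg (fun x ↦ f (x ^ 2)) (riemDist_mul_left hbi h p q),
    fun _ _ _ _ hV _ _ hab _ hg ↦
      ⟨necessaryConditions_iff hbi hcov hV (uniqueDiffOn_Icc hab) hg,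
        reducedConditions_iff hbi hcov (uniqueDiffOn_Icc hab) hg⟩⟩
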